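/- Let $G$ be a finite-dimensional (smooth, Hausdorff) Lie group with Lie algebra $\mathfrak g$ and let $g$ be an inner product on $\mathfrak g$, inducing a left-invariant Riemannian metric on $G$. Define $\mathrm{ad}^\star_u$ by $g(\mathrm{ad}^\star_u v,w)=g(v,\mathrm{ad}_u w)$ for all $u,v,w\in\mathfrak g$. Geodesics of the metric are the curves $\gamma$ in $G$ with $\gamma'(t)=\gamma(t)u(t)$, where $u$ solves the Euler--Arnold equation $u'(t)=\mathrm{ad}^\star_{u(t)}u(t)$. The Riemannian exponential map $\exp:\mathfrak g\to G$ sends $v$ to $\gamma(1)$, where $\gamma$ is the geodesic with $\gamma(0)=\mathrm{id}$, $\gamma'(0)=v$. A conjugate point along the geodesic $t\mapsto\exp(tu_0)$ is a value $\exp(\tau u_0)$, $\tau>0$, such that the linear map $D(\exp)(\tau u_0):\mathfrak g\to T_{\exp(\tau u_0)}G$ is singular. Theorem. Suppose $u_0\in\mathfrak g$ is a steady solution of the Euler--Arnold equation, i.e. $\mathrm{ad}^\star_{u_0}u_0=0$. Let $L$ and $F$ be the linear operators on $\mathfrak g$ defined by $$L(v)=\mathrm{ad}_{u_0}v,\qquad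 F(v)=\mathrm{ad}^\star_{u_0}v+\mathrm{ad}^\star_v u_0 .$$ Then both operators map the $g$-orthogonal complement $u_0^\perp$ of $u_0$ to itself. Moreover, if $R:u_0^\perp\to u_0^\perp$ is a linear operator such that $RF+LR=I$ on $u_0^\perp$, then there is a conjugate point along the geodesic $t\mapsto\exp(tu_0)$ if and only if for some $\tau>0$ $$\det\left(e^{\tau L}Re^{\tau F}-e^{-\tau L}Re^{-\tau F}\right)=0,$$ where $L$, $F$ and the determinant are taken on $u_0^\perp$. -/

import Mathlib

open scoped Manifold ContDiff

noncomputable section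

/-- An inner product on a real vector space. -/
structure InnerProd (V : Type*) [AddCommGroup V] [Module ℝ V] where
  form : LinearMap.BilinForm ℝ V
  symm : ∀ v w, form v w = form w v
  pos : ∀ v, v ≠ 0 → 0 < form v v

namespace InnerProd

section VectorSpace

variable {V : Type*} [AddCommGroup V] [Module ℝ V] (g : InnerProd V)

theorem nondegenerate : g.form.Nondegenerate := by
  constructor
  · intro v hv
    by_contra h
    exact (g.pos v h).ne' (hv v)
  · intro v hv
    by_contra h
    exact (g.pos v h).ne' (hv v)

/-- The `g`-orthogonal complement of the line (or zero space) spanned by `u`. -/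
def perp (u : V) : Submodule ℝ V where
  carrier := {v | g.form v u = 0}
  add_mem' := by
    intro a b ha hb
    change g.form a u = 0 at ha
    change g.form b u = 0 at hb
    change g.form (a + b) u = 0
    rw [map_add, LinearMap.add_apply, ha, hb, add_zero]
  zero_mem' := by simp
  smul_mem' := by
    intro c a ha
    change g.form a u = 0 at ha
    change g.form (c • a) u = 0
    rw [map_smul, LinearMap.smul_apply, ha, smul_zero]

end VectorSpace

section LieAlgebra

variable {𝔤 : Type*} [LieRing 𝔤] [LieAlgebra ℝ 𝔤] [FiniteDimensional ℝ 𝔤] (g : InnerProd 𝔤)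

/-- The operator `ad⋆_u`, the `g`-adjoint of `ad_u`. -/
def adStar (u : 𝔤) : 𝔤 →ₗ[ℝ] 𝔤 :=
  g.form.leftAdjointOfNondegenerate g.nondegenerate (LieAlgebra.ad ℝ 𝔤 u)

/-- The defining condition of `ad⋆`: `g(ad⋆_u v, w) = g(v, ad_u w)`. -/
theorem form_adStar (u v w : 𝔤) : g.form (g.adStar u v) w = g.form v ⁅u, w⁆ :=
  LinearMap.BilinForm.isAdjointPairLeftAdjointOfNondegenerate g.form g.nondegenerate
    (LieAlgebra.ad ℝ 𝔤 u) v w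

theorem eq_of_form_eq {x y : 𝔤} (h : ∀ w, g.form x w = g.form y w) : x = y := by
  by_contra hne
  have h1 := g.pos (x - y) (sub_ne_zero.mpr hne)
  have h2 : g.form (x - y) (x - y) = 0 := by
    rw [show g.form (x - y) = g.form x - g.form y from map_sub _ _ _, LinearMap.sub_apply,
      h, sub_self]
  rw [h2] at h1
  exact lt_irrefl _ h1

/-- The operator `L = ad_{u₀}`. -/
def opL (u₀ : 𝔤) : 𝔤 →ₗ[ℝ] 𝔤 := LieAlgebra.ad ℝ 𝔤 u₀

/-- The operator `F(v) = ad⋆_{u₀} v + ad⋆_v u₀`. -/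
def opF (u₀ : 𝔤) : 𝔤 →ₗ[ℝ] 𝔤 where
  toFun v := g.adStar u₀ v + g.adStar v u₀
  map_add' v w := by
    apply g.eq_of_form_eq
    intro x
    simp only [map_add, LinearMap.add_apply, form_adStar, add_lie]
    ring
  map_smul' c v := by
    apply g.eq_of_form_eq
    intro x
    simp only [map_add, map_smul, LinearMap.add_apply, LinearMap.smul_apply, form_adStar,
      smul_lie, smul_eq_mul, RingHom.id_apply]
    ring

/-- `u₀` is a steady solution of the Euler-Arnold equation `u' = ad⋆_u u`. -/
def IsSteady (u₀ : 𝔤) : Prop := g.adStar u₀ u₀ = 0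

end LieAlgebra

end InnerProd

/-- The exponential `e^A` of an endomorphism of a finite-dimensional real vector space: the matrix
exponential, read in a basis (on which it does not depend). -/
def endExp {V : Type*} [AddCommGroup V] [Module ℝ V] [FiniteDimensional ℝ V]
    (A : V →ₗ[ℝ] V) : V →ₗ[ℝ] V :=
  Matrix.toLin (Module.finBasis ℝ V) (Module.finBasis ℝ V)
    (NormedSpace.exp (LinearMap.toMatrix (Module.finBasis ℝ V) (Module.finBasis ℝ V) A))

section LieGroup

variable {E : Type*} [NormedAddCommGroup E] [NormedSpace ℝ E]
  {G : Type*} [TopologicalSpace G] [ChartedSpace E G] [Group G]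

instance smoothLieGroup_three [LieGroup 𝓘(ℝ, E) ∞ G] :
    LieGroup 𝓘(ℝ, E) (minSmoothness ℝ 3) G := by
  rw [minSmoothness_of_isRCLikeNormedField]
  exact LieGroup.of_le (n := ∞) (by
    have h : ((3 : ℕ∞) : WithTop ℕ∞) ≤ ((⊤ : ℕ∞) : WithTop ℕ∞) := WithTop.coe_le_coe.mpr le_top
    exact h)

instance finiteDimensional_groupLieAlgebra [FiniteDimensional ℝ E] :
    FiniteDimensional ℝ (GroupLieAlgebra 𝓘(ℝ, E) G) :=
  inferInstanceAs (FiniteDimensional ℝ E)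

variable [LieGroup 𝓘(ℝ, E) ∞ G] [FiniteDimensional ℝ E]

/-- `γ : ℝ → G` is a geodesic of the left-invariant metric `g`, with left-translated velocity
`u = γ⁻¹ γ'`: the flow equation `γ'(t) = γ(t) u(t)` and the Euler-Arnold equation
`u'(t) = ad⋆_{u(t)} u(t)` hold. -/
structure IsGeodesic (g : InnerProd (GroupLieAlgebra 𝓘(ℝ, E) G)) (γ : ℝ → G)
    (u : ℝ → GroupLieAlgebra 𝓘(ℝ, E) G) : Prop where
  flow : ∀ t, HasMFDerivAt 𝓘(ℝ, ℝ) 𝓘(ℝ, E) γ t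
    (ContinuousLinearMap.toSpanSingleton ℝ
      (mulInvariantVectorField (u t) (γ t) : TangentSpace 𝓘(ℝ, E) (γ t)))
  eulerArnold : ∀ t, HasDerivAt (F := E) u (g.adStar (u t) (u t)) t

open Classical in
/-- The Riemannian exponential map at the identity, `exp v = γ(1)` for the geodesic `γ` with
`γ(0) = 1` and `γ'(0) = v`. Its domain is the Lie algebra, written as the normed space `E` which
underlies it. -/
def riemannianExp (g : InnerProd (GroupLieAlgebra 𝓘(ℝ, E) G)) (v : E) : G :=
  if h : ∃ p : (ℝ → G) × (ℝ → GroupLieAlgebra 𝓘(ℝ, E) G),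
      IsGeodesic g p.1 p.2 ∧ p.1 0 = 1 ∧ p.2 0 = v
  then h.choose.1 1 else 1

/-- The value `exp(τ u₀)` is a conjugate point along the geodesic `t ↦ exp(t u₀)`: the derivative
of `exp` at `τ u₀` is singular. (Differentiability is stated so that no default value of `mfderiv`
can count as a singular derivative.) -/
def IsConjugateTime (g : InnerProd (GroupLieAlgebra 𝓘(ℝ, E) G))
    (u₀ : GroupLieAlgebra 𝓘(ℝ, E) G) (τ : ℝ) : Prop :=
  MDifferentiableAt 𝓘(ℝ, E) 𝓘(ℝ, E) (riemannianExp g) (τ • u₀ : E) ∧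
  ¬ Function.Bijective (mfderiv 𝓘(ℝ, E) 𝓘(ℝ, E) (riemannianExp g) (τ • u₀ : E))

end LieGroup

end

/-!
Let `h = γ₀⁻¹ γ`, where `γ₀` is the steady geodesic `t ↦ exp(t u₀)` and `γ` a geodesic from the
identity with left-translated velocity `u`. Then `h' = h u - u₀ h` and `u' = ad⋆_u u`. In a chart
at the identity this is an autonomous system (`relativeField`) of which `(1, u₀)` is an
equilibrium, and its linearization there is `y' = z - L y`, `z' = F z`
(`hasFDerivAt_relativeField`): the derivatives of the left- and the right-invariant field combine
into the Lie bracket, since the second derivative of the multiplication is symmetric and its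
antisymmetrized mixed part is the bracket (`lie_eq_chartMulSnd`). Near an equilibrium, Grönwall's
inequality alone shows that solutions depend differentiably on their initial value, with
derivative given by the linearized equation (`hasFDerivAt_of_equilibrium`). So the smooth
dependence of flows on parameters is not needed, and the derivative of `exp` at `τ u₀` is, up to a
left translation and the factor `τ⁻¹`, the map `Y : z(0) ↦ y(τ)` where `y(0) = 0`
(`exists_hasModelDerivAt_riemannianExp`).

For `exp` to be the map intended, geodesics have to exist for all times and be unique
(`exists_isGeodesic`, `IsGeodesic.curve_eq`). The Euler-Arnold equation conserves `g(u, u)`, hence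
its solutions are global; `γ' = γ u` is then solved locally in the chart at the identity, and
local solutions are glued after left translations, as two solutions differ by a constant left
factor.

The operators `L` and `F` vanish on `u₀` and preserve `u₀^⊥`. On the line of `u₀` the map `Y` is
multiplication by `τ`; on `u₀^⊥` the identity `R F + L R = 1` says that `R e^{τF} - e^{-τL} R`
(`solutionOp`) solves the linearized equation. Finally `e^{σL} R e^{σF} - e^{-σL} R e^{-σF} =
e^{σL} (R e^{2σF} - e^{-2σL} R) e^{-σF}`, so the determinant in the theorem vanishes at `σ`
exactly if `exp` is singular at `2σ u₀`.
-/

open Set Filter Topology VectorField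

/-! ### Ordinary differential equations -/

section Ode
variable {E : Type*} [NormedAddCommGroup E] [NormedSpace ℝ E] [FiniteDimensional ℝ E]

/-- A bounded `C¹` field on `E` has a global integral curve through each point: all local solutions
live for a common time. -/
theorem exists_forall_hasDerivAt_of_bounded {f : E → E} (hf : ContDiff ℝ 1 f) {C : ℝ}
    (hC : ∀ x, ‖f x‖ ≤ C) (x : E) :
    ∃ α : ℝ → E, α 0 = x ∧ ∀ t, HasDerivAt α (f (α t)) t := by
  have hC0 : 0 ≤ C := (norm_nonneg _).trans (hC x)
  have hv : ContMDiff 𝓘(ℝ, E) 𝓘(ℝ, E).tangent 1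
      (fun y => (⟨y, f y⟩ : TangentBundle 𝓘(ℝ, E) E)) :=
    contMDiff_vectorSpace_iff_contDiff.mpr hf
  -- On the unit ball around any point the field is bounded by `C`, so `1 / (C + 1)` is a lower
  -- bound for the existence time.
  obtain ⟨γ, h0, hγ⟩ := exists_isMIntegralCurve_of_isMIntegralCurveOn
    (M := E) (I := 𝓘(ℝ, E)) (v := f) hv (ε := 1 / (C + 1)) (by positivity) (fun z => by
      obtain ⟨K, hK⟩ := hf.contDiffOn.exists_lipschitzOnWith (s := Metric.closedBall z 1)
        one_ne_zero (convex_closedBall z 1) (isCompact_closedBall z 1)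
      have hε : (0 : ℝ) < 1 / (C + 1) := by positivity
      have hpl : IsPicardLindelof (fun _ => f) (tmin := -(1 / (C + 1))) (tmax := 1 / (C + 1))
          ⟨0, by constructor <;> linarith⟩ z 1 0 ⟨C, hC0⟩ K := by
        refine IsPicardLindelof.of_time_independent (fun y _ => hC y) (by simpa using hK) ?_
        simp only [sub_zero, sub_neg_eq_add, zero_add, max_self, NNReal.coe_one,
          NNReal.coe_zero]
        rw [mul_one_div, div_le_one (by positivity)]
        exact le_add_of_nonneg_right zero_le_one
      obtain ⟨α, hα0, hα⟩ := hpl.exists_eq_forall_mem_Icc_hasDerivWithinAt₀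
      exact ⟨α, hα0, fun t ht => ((hα t (Ioo_subset_Icc_self ht)).mono
        Ioo_subset_Icc_self).hasFDerivWithinAt.hasMFDerivWithinAt⟩) x
  refine ⟨γ, h0, fun t => ?_⟩
  have h : HasFDerivAt γ ((1 : ℝ →L[ℝ] ℝ).smulRight (f (γ t))) t := (hγ t).hasFDerivAt
  simpa using h.hasDerivAt

omit [FiniteDimensional ℝ E] in
theorem eq_of_forall_hasDerivAt [CompleteSpace E] {f : E → E} (hf : ContDiff ℝ 1 f) {α β : ℝ → E}
    (hα : ∀ t, HasDerivAt α (f (α t)) t) (hβ : ∀ t, HasDerivAt β (f (β t)) t)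
    (h0 : α 0 = β 0) : α = β := by
  have hv : ContMDiff 𝓘(ℝ, E) 𝓘(ℝ, E).tangent 1
      (fun y => (⟨y, f y⟩ : TangentBundle 𝓘(ℝ, E) E)) :=
    contMDiff_vectorSpace_iff_contDiff.mpr hf
  exact isMIntegralCurve_Ioo_eq_of_contMDiff_boundaryless (M := E) (I := 𝓘(ℝ, E)) (v := f)
    (t₀ := 0) hv (fun t => (hα t).hasFDerivAt.hasMFDerivAt)
    (fun t => (hβ t).hasFDerivAt.hasMFDerivAt) h0

theorem InnerProd.exists_mul_sq_norm_le (g : InnerProd E) :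
    ∃ k > 0, ∀ u, k * ‖u‖ ^ 2 ≤ g.form u u := by
  have hcont : Continuous fun u => g.form u u := by
    let g' : E →L[ℝ] E →L[ℝ] ℝ :=
      LinearMap.toContinuousLinearMap (LinearMap.toContinuousLinearMap.toLinearMap ∘ₗ g.form)
    change Continuous fun u => g' u u
    fun_prop
  rcases subsingleton_or_nontrivial E with h | h
  · exact ⟨1, one_pos, fun u => by simp [Subsingleton.elim u 0]⟩
  obtain ⟨e, he, hmin⟩ := (isCompact_sphere (0 : E) 1).exists_isMinOn
    (NormedSpace.sphere_nonempty.mpr zero_le_one) hcont.continuousOn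
  have he0 : e ≠ 0 := by
    rintro rfl
    simp at he
  refine ⟨g.form e e, g.pos e he0, fun u => ?_⟩
  rcases eq_or_ne u 0 with rfl | hu
  · simp
  have hn : ‖u‖ ≠ 0 := norm_ne_zero_iff.mpr hu
  have h1 : g.form e e ≤ g.form (‖u‖⁻¹ • u) (‖u‖⁻¹ • u) :=
    hmin (by simp [norm_smul, hn])
  simp only [map_smul, LinearMap.smul_apply, smul_eq_mul] at h1
  calc g.form e e * ‖u‖ ^ 2 ≤ (‖u‖⁻¹ * (‖u‖⁻¹ * g.form u u)) * ‖u‖ ^ 2 := by gcongr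
    _ = g.form u u := by field_simp

theorem contDiff_bilin_diag {F : Type*} [NormedAddCommGroup F] [NormedSpace ℝ F]
    (b : E →ₗ[ℝ] E →ₗ[ℝ] F) {n : WithTop ℕ∞} :
    ContDiff ℝ n fun u => b u u := by
  let b' : E →L[ℝ] E →L[ℝ] F :=
    LinearMap.toContinuousLinearMap (LinearMap.toContinuousLinearMap.toLinearMap ∘ₗ b)
  exact b'.isBoundedBilinearMap.contDiff.comp (contDiff_id.prodMk contDiff_id)

theorem hasDerivAt_bilin_diag {F : Type*} [NormedAddCommGroup F] [NormedSpace ℝ F]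
    (b : E →ₗ[ℝ] E →ₗ[ℝ] F) {u : ℝ → E} {u' : E} {t : ℝ} (hu : HasDerivAt u u' t) :
    HasDerivAt (fun s => b (u s) (u s)) (b (u t) u' + b u' (u t)) t := by
  let b' : E →L[ℝ] E →L[ℝ] F :=
    LinearMap.toContinuousLinearMap (LinearMap.toContinuousLinearMap.toLinearMap ∘ₗ b)
  have h := (b'.isBoundedBilinearMap.hasFDerivAt (u t, u t)).comp_hasDerivAt t (hu.prodMk hu)
  exact h

/-- A quadratic equation `u' = b(u, u)` that conserves a definite quadratic form has global
solutions: divided by `1 + g(u, u)` the field is bounded, and along its integral curves the divisor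
is constant, so that they solve the original equation after a linear change of time. -/
theorem InnerProd.exists_forall_hasDerivAt_bilin_diag (g : InnerProd E) (b : E →ₗ[ℝ] E →ₗ[ℝ] E)
    (hb : ∀ u, g.form (b u u) u = 0) (v : E) :
    ∃ u : ℝ → E, u 0 = v ∧ ∀ t, HasDerivAt u (b (u t) (u t)) t := by
  have hN0 : ∀ u, 0 ≤ g.form u u := fun u => by
    rcases eq_or_ne u 0 with rfl | hu
    · simp
    · exact (g.pos u hu).le
  have hN1 : ∀ u, 0 < 1 + g.form u u := fun u => by linarith [hN0 u]
  set f : E → E := fun u => (1 + g.form u u)⁻¹ • b u u with hf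
  have hfc : ContDiff ℝ 1 f :=
    ((contDiff_const.add (contDiff_bilin_diag g.form)).inv fun u => (hN1 u).ne').smul
      (contDiff_bilin_diag b)
  obtain ⟨k, hk, hkN⟩ := g.exists_mul_sq_norm_le
  let b' : E →L[ℝ] E →L[ℝ] E :=
    LinearMap.toContinuousLinearMap (LinearMap.toContinuousLinearMap.toLinearMap ∘ₗ b)
  have hfb : ∀ u, ‖f u‖ ≤ ‖b'‖ / k := fun u => by
    have h1 : ‖b u u‖ ≤ ‖b'‖ * ‖u‖ * ‖u‖ := b'.le_opNorm₂ u u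
    rw [hf, norm_smul, norm_inv, Real.norm_of_nonneg (hN1 u).le, inv_mul_le_iff₀ (hN1 u),
      mul_div_assoc', le_div_iff₀ hk]
    have h2 := mul_le_mul_of_nonneg_left (hkN u) (norm_nonneg b')
    nlinarith [norm_nonneg b']
  obtain ⟨α, h0, hα⟩ := exists_forall_hasDerivAt_of_bounded hfc hfb v
  have hconst : ∀ t, g.form (α t) (α t) = g.form v v := by
    have hd : ∀ t, HasDerivAt (fun s => g.form (α s) (α s)) 0 t := fun t => by
      refine (hasDerivAt_bilin_diag g.form (hα t)).congr_deriv ?_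
      rw [g.symm (α t), hf]
      simp [hb]
    intro t
    rw [is_const_of_deriv_eq_zero (fun s => (hd s).differentiableAt) (fun s => (hd s).deriv) t 0,
      h0]
  refine ⟨fun t => α ((1 + g.form v v) * t), by simpa using h0, fun t => ?_⟩
  have h1 := (hα ((1 + g.form v v) * t)).scomp t ((hasDerivAt_id t).const_mul (1 + g.form v v))
  refine h1.congr_deriv ?_
  rw [hf]
  simp only [hconst, mul_one, smul_smul]
  rw [mul_inv_cancel₀ (hN1 v).ne', one_smul]

omit [FiniteDimensional ℝ E] in
/-- Linearization at an equilibrium: if the curves `c w` on a manifold solve, in the chart `e`, an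
autonomous equation `x' = V(x)` with `V(p) = 0`, and start at `p + ι w`, then the time-`T` value
depends differentiably on `w` at `w = 0`, with derivative given by the solution of the linearized
equation. The curves are assumed to be defined for all times; that they stay in the chart up to
time `T` for small `w` is part of the conclusion. -/
theorem hasFDerivAt_of_equilibrium {F W M : Type*} [NormedAddCommGroup F] [NormedSpace ℝ F]
    [ProperSpace F] [NormedAddCommGroup W] [NormedSpace ℝ W] [TopologicalSpace M] [T2Space M]
    (e : OpenPartialHomeomorph M F) {V : F → F} {A : F →L[ℝ] F} {p : F} (hp : p ∈ e.target)
    (hV : HasFDerivAt V A p) (hVp : V p = 0) (ι : W →L[ℝ] F) {c : W → ℝ → M}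
    (hcont : ∀ w, Continuous (c w)) (hc0 : ∀ᶠ w in 𝓝 0, c w 0 ∈ e.source ∧ e (c w 0) = p + ι w)
    (hc : ∀ w t, c w t ∈ e.source → HasDerivAt (fun s => e (c w s)) (V (e (c w t))) t)
    {y : W → ℝ → F} (hy0 : ∀ w, y w 0 = ι w) (hy : ∀ w t, HasDerivAt (y w) (A (y w t)) t)
    {T : ℝ} (hT : 0 ≤ T) (Y : W →L[ℝ] F) (hY : ∀ w, y w T = Y w) :
    (∀ᶠ w in 𝓝 0, c w T ∈ e.source) ∧ e (c 0 T) = p ∧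
      HasFDerivAt (fun w => e (c w T)) Y 0 := by
  set K : ℝ := ‖A‖ + 1 with hK
  have hK0 : 0 < K := by positivity
  set D : ℝ := Real.exp (K * T) with hD
  have hD0 : 0 < D := Real.exp_pos _
  -- On a small ball the field is close to its linearization, and a curve which starts close enough
  -- to `p` stays in that ball up to time `T`.
  have key : ∀ ε > 0, ε ≤ 1 → ∀ᶠ w in 𝓝 (0 : W), ∀ t ∈ Icc 0 T, c w t ∈ e.source ∧
      ‖e (c w t) - p‖ ≤ ‖ι w‖ * D ∧
      ‖V (e (c w t)) - A (e (c w t) - p)‖ ≤ ε * ‖e (c w t) - p‖ := by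
    intro ε hε hε1
    have h1 : ∀ᶠ x in 𝓝 p, ‖V x - A (x - p)‖ ≤ ε * ‖x - p‖ := by
      simpa [hVp] using hV.isLittleO.def hε
    obtain ⟨r, hr, hball⟩ := Metric.nhds_basis_closedBall.mem_iff.mp
      (inter_mem h1 (e.open_target.mem_nhds hp))
    have h2 : ∀ᶠ w in 𝓝 (0 : W), ‖ι w‖ * D < r := by
      have : Tendsto (fun w => ‖ι w‖ * D) (𝓝 0) (𝓝 (‖ι 0‖ * D)) :=
        Continuous.tendsto (by fun_prop) 0
      exact this.eventually_lt_const (by simpa using hr)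
    filter_upwards [h2, hc0] with w hw ⟨hw0, hw1⟩
    have hNc : IsClosed (e.symm '' Metric.closedBall p r) :=
      ((isCompact_closedBall p r).image_of_continuousOn
        (e.continuousOn_symm.mono fun x hx => (hball hx).2)).isClosed
    have hNo : IsOpen (e.source ∩ e ⁻¹' Metric.ball p r) :=
      e.isOpen_inter_preimage Metric.isOpen_ball
    have hsub : e.source ∩ e ⁻¹' Metric.ball p r ⊆ e.symm '' Metric.closedBall p r :=
      fun x hx => ⟨e x, Metric.ball_subset_closedBall hx.2, e.left_inv hx.1⟩
    have hN : ∀ x ∈ e.symm '' Metric.closedBall p r, x ∈ e.source ∧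
        e x ∈ Metric.closedBall p r := by
      rintro _ ⟨z, hz, rfl⟩
      exact ⟨e.map_target (hball hz).2, by rwa [e.right_inv (hball hz).2]⟩
    have gron : ∀ b ≤ T, (∀ t ∈ Icc 0 b, c w t ∈ e.symm '' Metric.closedBall p r) →
        ∀ t ∈ Icc 0 b, ‖e (c w t) - p‖ ≤ ‖ι w‖ * D := by
      intro b hb hin t ht
      have hder : ∀ t ∈ Icc 0 b, HasDerivAt (fun s => e (c w s) - p) (V (e (c w t))) t :=
        fun t ht => (hc w t (hN _ (hin t ht)).1).sub_const p
      have := norm_le_gronwallBound_of_norm_deriv_right_le (δ := ‖ι w‖) (K := K) (ε := 0)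
        (fun t ht => (hder t ht).continuousAt.continuousWithinAt)
        (fun t ht => (hder t (Ico_subset_Icc_self ht)).hasDerivWithinAt)
        (by simp [hw1]) (fun t ht => by
          have h3 : ‖V (e (c w t)) - A (e (c w t) - p)‖ ≤ ε * ‖e (c w t) - p‖ :=
            (hball (hN _ (hin t (Ico_subset_Icc_self ht))).2).1
          have h4 := A.le_opNorm (e (c w t) - p)
          have h5 := norm_sub_norm_le (V (e (c w t))) (A (e (c w t) - p))
          have h6 := mul_le_mul_of_nonneg_right hε1 (norm_nonneg (e (c w t) - p))
          rw [hK]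
          linarith) t ht
      rw [gronwallBound_ε0, sub_zero] at this
      refine this.trans ?_
      rw [hD]
      gcongr
      exact ht.2.trans hb
    have hin : ∀ t ∈ Icc 0 T, c w t ∈ e.source ∩ e ⁻¹' Metric.ball p r := by
      by_contra! hcon
      obtain ⟨t₁, ht₁, hbad⟩ := hcon
      -- the first time at which the curve is outside the open ball
      obtain ⟨s, ⟨hs, hsbad⟩, hmin⟩ := (isCompact_Icc.inter_right
        (hNo.isClosed_compl.preimage (hcont w))).exists_isLeast ⟨t₁, ht₁, hbad⟩
      have hlt : ∀ t ∈ Ico 0 s, c w t ∈ e.source ∩ e ⁻¹' Metric.ball p r := by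
        intro t ht
        by_contra h
        exact absurd (hmin ⟨⟨ht.1, ht.2.le.trans hs.2⟩, h⟩) (not_le.mpr ht.2)
      have hs0 : 0 < s := by
        refine lt_of_le_of_ne hs.1 fun h => hsbad ?_
        rw [← h]
        refine ⟨hw0, ?_⟩
        have : ‖ι w‖ * 1 ≤ ‖ι w‖ * D := by
          gcongr
          exact Real.one_le_exp (by positivity)
        simp only [mem_preimage, hw1, Metric.mem_ball, dist_eq_norm, add_sub_cancel_left]
        linarith
      have hle : ∀ t ∈ Icc 0 s, c w t ∈ e.symm '' Metric.closedBall p r := by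
        have h7 : closure (Ico 0 s) ⊆ c w ⁻¹' (e.symm '' Metric.closedBall p r) :=
          closure_minimal (fun t ht => hsub (hlt t ht)) (hNc.preimage (hcont w))
        rw [closure_Ico hs0.ne] at h7
        exact h7
      have h8 := gron s hs.2 hle s ⟨hs0.le, le_rfl⟩
      refine hsbad ⟨(hN _ (hle s ⟨hs0.le, le_rfl⟩)).1, ?_⟩
      rw [mem_preimage, Metric.mem_ball, dist_eq_norm]
      exact h8.trans_lt hw
    intro t ht
    refine ⟨(hin t ht).1, gron T le_rfl (fun t ht => hsub (hin t ht)) t ht, ?_⟩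
    exact (hball (Metric.ball_subset_closedBall (hin t ht).2)).1
  have hTmem : T ∈ Icc 0 T := ⟨hT, le_rfl⟩
  have hzero : e (c 0 T) = p := by
    have := ((key 1 one_pos le_rfl).self_of_nhds T hTmem).2.1
    simpa [sub_eq_zero] using this
  refine ⟨(key 1 one_pos le_rfl).mono fun w h => (h T hTmem).1, hzero, ?_⟩
  rw [hasFDerivAt_iff_isLittleO, Asymptotics.isLittleO_iff]
  intro a ha
  set B : ℝ := ‖ι‖ * D * (D / K) with hB
  have hB0 : 0 ≤ B := by positivity
  set ε : ℝ := min 1 (a / (B + 1)) with hε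
  have hε0 : 0 < ε := lt_min one_pos (by positivity)
  filter_upwards [key ε hε0 (min_le_left _ _), hc0] with w hw ⟨_, hw1⟩
  -- Grönwall for the difference between the curve and the solution of the linearized equation
  have hder : ∀ t ∈ Icc 0 T, HasDerivAt (fun s => e (c w s) - p - y w s)
      (V (e (c w t)) - A (y w t)) t :=
    fun t ht => ((hc w t (hw t ht).1).sub_const p).sub (hy w t)
  have h1 := norm_le_gronwallBound_of_norm_deriv_right_le (δ := 0) (K := K)
    (ε := ε * (‖ι w‖ * D))
    (fun t ht => (hder t ht).continuousAt.continuousWithinAt)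
    (fun t ht => (hder t (Ico_subset_Icc_self ht)).hasDerivWithinAt)
    (by simp [hw1, hy0]) (fun t ht => by
      obtain ⟨-, h2, h3⟩ := hw t (Ico_subset_Icc_self ht)
      have h4 := A.le_opNorm (e (c w t) - p - y w t)
      have h5 : V (e (c w t)) - A (y w t) =
          (V (e (c w t)) - A (e (c w t) - p)) + A (e (c w t) - p - y w t) := by
        rw [map_sub A (e (c w t) - p)]
        abel
      rw [h5]
      have h6 := norm_add_le (V (e (c w t)) - A (e (c w t) - p)) (A (e (c w t) - p - y w t))
      have h7 := mul_le_mul_of_nonneg_left h2 hε0.le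
      have h8 := norm_nonneg (e (c w t) - p - y w t)
      rw [hK]
      linarith) T hTmem
  simp only [gronwallBound_of_K_ne_0 hK0.ne'] at h1
  rw [zero_mul, zero_add, sub_zero, ← hD] at h1
  rw [hzero, sub_zero, ← hY]
  refine h1.trans ?_
  calc ε * (‖ι w‖ * D) / K * (D - 1) ≤ ε * (‖ι w‖ * D) / K * D := by gcongr; linarith
    _ ≤ ε * (‖ι‖ * ‖w‖ * D) / K * D := by gcongr; exact ι.le_opNorm w
    _ = ε * B * ‖w‖ := by rw [hB]; ring
    _ ≤ a / (B + 1) * (B + 1) * ‖w‖ := by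
        gcongr
        · exact min_le_right _ _
        · linarith
    _ = a * ‖w‖ := by rw [div_mul_cancel₀ _ (by positivity)]

end Ode

/-! ### The group multiplication in a chart at the identity -/

section Manifold

variable {E₁ E₂ E₃ : Type*} [NormedAddCommGroup E₁] [NormedSpace ℝ E₁] [NormedAddCommGroup E₂]
  [NormedSpace ℝ E₂] [NormedAddCommGroup E₃] [NormedSpace ℝ E₃]
  {M₁ M₂ M₃ : Type*} [TopologicalSpace M₁] [ChartedSpace E₁ M₁] [TopologicalSpace M₂]
  [ChartedSpace E₂ M₂] [TopologicalSpace M₃] [ChartedSpace E₃ M₃]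

/-- The chain rule, with the derivatives typed as maps between the model spaces. -/
theorem HasMFDerivAt.comp_of_eq {g : M₂ → M₃} {f : M₁ → M₂} {y : M₂} {x : M₁}
    {g' : E₂ →L[ℝ] E₃} {f' : E₁ →L[ℝ] E₂}
    (hg : HasMFDerivAt 𝓘(ℝ, E₂) 𝓘(ℝ, E₃) g y g') (hf : HasMFDerivAt 𝓘(ℝ, E₁) 𝓘(ℝ, E₂) f x f')
    (h : f x = y) : HasMFDerivAt 𝓘(ℝ, E₁) 𝓘(ℝ, E₃) (fun z => g (f z)) x (g'.comp f') := by
  subst h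
  exact HasMFDerivAt.comp x hg hf

end Manifold

section Chart
variable {E : Type*} [NormedAddCommGroup E] [NormedSpace ℝ E]
  {G : Type*} [TopologicalSpace G] [ChartedSpace E G] [Group G]

variable (E G) in
/-- The multiplication of `G` read in the preferred chart at the identity. -/
noncomputable def chartMul (p : E × E) : E :=
  extChartAt 𝓘(ℝ, E) (1 : G) ((extChartAt 𝓘(ℝ, E) (1 : G)).symm p.1 *
    (extChartAt 𝓘(ℝ, E) (1 : G)).symm p.2)

variable (E G) in
/-- The coordinates of the identity in the preferred chart there. -/
noncomputable def chartOne : E := extChartAt 𝓘(ℝ, E) (1 : G) 1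

variable (E G) in
/-- The left-invariant field with value `u` at the identity, read in the chart: its value at `x`. -/
noncomputable def chartLeft (x u : E) : E :=
  fderiv ℝ (chartMul E G) (x, chartOne E G) (0, u)

variable (E G) in
/-- The right-invariant field with value `v` at the identity, read in the chart: its value at
`x`. -/
noncomputable def chartRight (x v : E) : E :=
  fderiv ℝ (chartMul E G) (chartOne E G, x) (v, 0)

theorem chartOne_mem_target : chartOne E G ∈ (extChartAt 𝓘(ℝ, E) (1 : G)).target :=
  mem_extChartAt_target _

theorem extChartAt_symm_chartOne : (extChartAt 𝓘(ℝ, E) (1 : G)).symm (chartOne E G) = 1 :=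
  extChartAt_to_inv _

variable [LieGroup 𝓘(ℝ, E) ∞ G]

theorem contDiffAt_chartMul {x y : E} (hx : x ∈ (extChartAt 𝓘(ℝ, E) (1 : G)).target)
    (hy : y ∈ (extChartAt 𝓘(ℝ, E) (1 : G)).target)
    (hxy : (extChartAt 𝓘(ℝ, E) (1 : G)).symm x * (extChartAt 𝓘(ℝ, E) (1 : G)).symm y ∈
      (extChartAt 𝓘(ℝ, E) (1 : G)).source) :
    ContDiffAt ℝ ∞ (chartMul E G) (x, y) := by
  have hsymm : ∀ z ∈ (extChartAt 𝓘(ℝ, E) (1 : G)).target,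
      ContMDiffAt 𝓘(ℝ, E) 𝓘(ℝ, E) ∞ (extChartAt 𝓘(ℝ, E) (1 : G)).symm z := fun z hz =>
    (contMDiffOn_extChartAt_symm (n := ∞) (I := 𝓘(ℝ, E)) (1 : G)).contMDiffAt
      ((isOpen_extChartAt_target (I := 𝓘(ℝ, E)) (1 : G)).mem_nhds hz)
  have hφ : ContMDiffAt 𝓘(ℝ, E) 𝓘(ℝ, E) ∞ (extChartAt 𝓘(ℝ, E) (1 : G))
      ((extChartAt 𝓘(ℝ, E) (1 : G)).symm x * (extChartAt 𝓘(ℝ, E) (1 : G)).symm y) :=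
    contMDiffAt_extChartAt' (by rwa [extChartAt_source] at hxy)
  have h1 : ContMDiffAt 𝓘(ℝ, E × E) 𝓘(ℝ, E) ∞
      (fun p : E × E => (extChartAt 𝓘(ℝ, E) (1 : G)).symm p.1) (x, y) :=
    (hsymm x hx).comp (x, y) (contDiff_fst.contMDiff.contMDiffAt)
  have h2 : ContMDiffAt 𝓘(ℝ, E × E) 𝓘(ℝ, E) ∞
      (fun p : E × E => (extChartAt 𝓘(ℝ, E) (1 : G)).symm p.2) (x, y) :=
    (hsymm y hy).comp (x, y) (contDiff_snd.contMDiff.contMDiffAt)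
  exact (ContMDiffAt.comp (x, y) hφ (h1.mul h2)).contDiffAt

theorem contDiffAt_chartMul_left {x : E} (hx : x ∈ (extChartAt 𝓘(ℝ, E) (1 : G)).target) :
    ContDiffAt ℝ ∞ (chartMul E G) (x, chartOne E G) :=
  contDiffAt_chartMul hx chartOne_mem_target (by
    rw [extChartAt_symm_chartOne, mul_one]; exact (extChartAt 𝓘(ℝ, E) (1 : G)).map_target hx)

theorem contDiffAt_chartMul_right {x : E} (hx : x ∈ (extChartAt 𝓘(ℝ, E) (1 : G)).target) :
    ContDiffAt ℝ ∞ (chartMul E G) (chartOne E G, x) :=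
  contDiffAt_chartMul chartOne_mem_target hx (by
    rw [extChartAt_symm_chartOne, one_mul]; exact (extChartAt 𝓘(ℝ, E) (1 : G)).map_target hx)

theorem hasMFDerivAt_mul_left (a b : G) :
    HasMFDerivAt 𝓘(ℝ, E) 𝓘(ℝ, E) (fun x : G => a * x) b
      (mfderiv 𝓘(ℝ, E) 𝓘(ℝ, E) (fun x : G => a * x) b) :=
  ((contMDiff_mul_left (I := 𝓘(ℝ, E)) (n := ∞) (a := a)).contMDiffAt.mdifferentiableAt
    (by simp)).hasMFDerivAt

theorem hasMFDerivAt_mul_right (a b : G) :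
    HasMFDerivAt 𝓘(ℝ, E) 𝓘(ℝ, E) (fun x : G => x * a) b
      (mfderiv 𝓘(ℝ, E) 𝓘(ℝ, E) (fun x : G => x * a) b) :=
  ((contMDiff_mul_right (I := 𝓘(ℝ, E)) (n := ∞) (a := a)).contMDiffAt.mdifferentiableAt
    (by simp)).hasMFDerivAt

variable (E G) in
/-- At its base point the chart has the identity as derivative, since tangent vectors are read in
the preferred chart. -/
theorem hasMFDerivAt_extChartAt_symm_chartOne :
    HasMFDerivAt 𝓘(ℝ, E) 𝓘(ℝ, E) (extChartAt 𝓘(ℝ, E) (1 : G)).symm (chartOne E G)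
      (ContinuousLinearMap.id ℝ E) := by
  have : IsManifold 𝓘(ℝ, E) 1 G := IsManifold.of_le (n := ∞) (by simp)
  have h1 := (mdifferentiableWithinAt_extChartAt_symm (I := 𝓘(ℝ, E)) (x := (1 : G))
    chartOne_mem_target).hasMFDerivWithinAt
  have h2 := mfderivWithin_range_extChartAt_symm (I := 𝓘(ℝ, E)) (x := (1 : G))
  rw [chartOne] at h1 ⊢
  rw [h2] at h1
  rw [ModelWithCorners.range_eq_univ] at h1
  exact hasMFDerivWithinAt_univ.mp h1

/-- The chart at the identity carries the left-invariant field of `u` to `x ↦ chartLeft E G x u`. -/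
theorem mfderiv_extChartAt_mulInvariantVectorField {a : G}
    (ha : a ∈ (extChartAt 𝓘(ℝ, E) (1 : G)).source) (u : GroupLieAlgebra 𝓘(ℝ, E) G) :
    mfderiv 𝓘(ℝ, E) 𝓘(ℝ, E) (extChartAt 𝓘(ℝ, E) (1 : G)) a (mulInvariantVectorField u a) =
      chartLeft E G (extChartAt 𝓘(ℝ, E) (1 : G) a) u := by
  have : IsManifold 𝓘(ℝ, E) 1 G := IsManifold.of_le (n := ∞) (by simp)
  set x := extChartAt 𝓘(ℝ, E) (1 : G) a with hx
  have hxt : x ∈ (extChartAt 𝓘(ℝ, E) (1 : G)).target := (extChartAt 𝓘(ℝ, E) (1 : G)).map_source ha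
  have hxa : (extChartAt 𝓘(ℝ, E) (1 : G)).symm x = a := (extChartAt 𝓘(ℝ, E) (1 : G)).left_inv ha
  have h1 : HasFDerivAt (fun y => chartMul E G (x, y))
      ((fderiv ℝ (chartMul E G) (x, chartOne E G)).comp (ContinuousLinearMap.inr ℝ E E))
      (chartOne E G) :=
    ((contDiffAt_chartMul_left hxt).differentiableAt (by simp)).hasFDerivAt.comp _
      (hasFDerivAt_prodMk_right x (chartOne E G))
  have h2 := (mdifferentiableAt_extChartAt (I := 𝓘(ℝ, E)) (x := (1 : G)) (y := a)
    (by rwa [extChartAt_source] at ha)).hasMFDerivAt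
  have h3 := hasMFDerivAt_extChartAt_symm_chartOne E G
  have h4 := hasMFDerivAt_mul_left (E := E) a (1 : G)
  have h5 : HasMFDerivAt 𝓘(ℝ, E) 𝓘(ℝ, E) (fun y => chartMul E G (x, y)) (chartOne E G)
      ((mfderiv 𝓘(ℝ, E) 𝓘(ℝ, E) (extChartAt 𝓘(ℝ, E) (1 : G)) a).comp
        ((mfderiv 𝓘(ℝ, E) 𝓘(ℝ, E) (fun x : G => a * x) 1).comp (ContinuousLinearMap.id ℝ E))) := by
    have h6 := HasMFDerivAt.comp_of_eq h4 h3 extChartAt_symm_chartOne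
    have h7 := HasMFDerivAt.comp_of_eq h2 h6 (by rw [extChartAt_symm_chartOne, mul_one])
    refine h7.congr_of_eventuallyEq (Eventually.of_forall fun y => ?_)
    simp only [chartMul, hxa]
  have h6 := hasMFDerivAt_unique h5 h1.hasMFDerivAt
  exact congrArg (fun A : E →L[ℝ] E => A u) h6
end Chart

section Chart
variable {E : Type*} [NormedAddCommGroup E] [NormedSpace ℝ E]
  {G : Type*} [TopologicalSpace G] [ChartedSpace E G] [Group G]

/-- The right-invariant vector field with value `v` at the identity. -/
noncomputable def mulRightInvariantVectorField (v : GroupLieAlgebra 𝓘(ℝ, E) G) (a : G) :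
    TangentSpace 𝓘(ℝ, E) a :=
  mfderiv 𝓘(ℝ, E) 𝓘(ℝ, E) (fun x : G => x * a) (1 : G) v

variable [LieGroup 𝓘(ℝ, E) ∞ G]

/-- The chart at the identity carries the right-invariant field of `v` to
`x ↦ chartRight E G x v`. -/
theorem mfderiv_extChartAt_mulRightInvariantVectorField {a : G}
    (ha : a ∈ (extChartAt 𝓘(ℝ, E) (1 : G)).source) (v : GroupLieAlgebra 𝓘(ℝ, E) G) :
    mfderiv 𝓘(ℝ, E) 𝓘(ℝ, E) (extChartAt 𝓘(ℝ, E) (1 : G)) a (mulRightInvariantVectorField v a) =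
      chartRight E G (extChartAt 𝓘(ℝ, E) (1 : G) a) v := by
  have : IsManifold 𝓘(ℝ, E) 1 G := IsManifold.of_le (n := ∞) (by simp)
  set x := extChartAt 𝓘(ℝ, E) (1 : G) a with hx
  have hxt : x ∈ (extChartAt 𝓘(ℝ, E) (1 : G)).target := (extChartAt 𝓘(ℝ, E) (1 : G)).map_source ha
  have hxa : (extChartAt 𝓘(ℝ, E) (1 : G)).symm x = a := (extChartAt 𝓘(ℝ, E) (1 : G)).left_inv ha
  have h1 : HasFDerivAt (fun y => chartMul E G (y, x))
      ((fderiv ℝ (chartMul E G) (chartOne E G, x)).comp (ContinuousLinearMap.inl ℝ E E))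
      (chartOne E G) :=
    ((contDiffAt_chartMul_right hxt).differentiableAt (by simp)).hasFDerivAt.comp
      (f := fun y : E => (y, x)) _ (hasFDerivAt_prodMk_left (chartOne E G) x)
  have h2 := (mdifferentiableAt_extChartAt (I := 𝓘(ℝ, E)) (x := (1 : G)) (y := a)
    (by rwa [extChartAt_source] at ha)).hasMFDerivAt
  have h3 := hasMFDerivAt_extChartAt_symm_chartOne E G
  have h4 := hasMFDerivAt_mul_right (E := E) a (1 : G)
  have h5 : HasMFDerivAt 𝓘(ℝ, E) 𝓘(ℝ, E) (fun y => chartMul E G (y, x)) (chartOne E G)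
      ((mfderiv 𝓘(ℝ, E) 𝓘(ℝ, E) (extChartAt 𝓘(ℝ, E) (1 : G)) a).comp
        ((mfderiv 𝓘(ℝ, E) 𝓘(ℝ, E) (fun x : G => x * a) 1).comp (ContinuousLinearMap.id ℝ E))) := by
    have h6 := HasMFDerivAt.comp_of_eq h4 h3 extChartAt_symm_chartOne
    have h7 := HasMFDerivAt.comp_of_eq h2 h6 (by rw [extChartAt_symm_chartOne, one_mul])
    refine h7.congr_of_eventuallyEq (Eventually.of_forall fun y => ?_)
    simp only [chartMul, hxa]
  have h6 := hasMFDerivAt_unique h5 h1.hasMFDerivAt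
  exact congrArg (fun A : E →L[ℝ] E => A v) h6

omit [LieGroup 𝓘(ℝ, E) ∞ G] in
theorem extChartAt_target_mem_nhds_chartOne :
    (extChartAt 𝓘(ℝ, E) (1 : G)).target ∈ 𝓝 (chartOne E G) :=
  extChartAt_target_mem_nhds (I := 𝓘(ℝ, E)) (1 : G)

theorem chartLeft_chartOne (u : E) : chartLeft E G (chartOne E G) u = u := by
  have h1 : HasFDerivAt (fun y => chartMul E G (chartOne E G, y))
      ((fderiv ℝ (chartMul E G) (chartOne E G, chartOne E G)).comp
        (ContinuousLinearMap.inr ℝ E E)) (chartOne E G) :=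
    ((contDiffAt_chartMul_left chartOne_mem_target).differentiableAt
    (by simp)).hasFDerivAt.comp _
      (hasFDerivAt_prodMk_right (chartOne E G) (chartOne E G))
  have h2 : (fun y => chartMul E G (chartOne E G, y)) =ᶠ[𝓝 (chartOne E G)] id := by
    filter_upwards [extChartAt_target_mem_nhds_chartOne (G := G)] with y hy
    simp only [chartMul, extChartAt_symm_chartOne, one_mul, id]
    exact (extChartAt 𝓘(ℝ, E) (1 : G)).right_inv hy
  exact congrArg (fun A : E →L[ℝ] E => A u)
    (h1.unique ((hasFDerivAt_id _).congr_of_eventuallyEq h2))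

theorem chartRight_chartOne (v : E) : chartRight E G (chartOne E G) v = v := by
  have h1 : HasFDerivAt (fun y => chartMul E G (y, chartOne E G))
      ((fderiv ℝ (chartMul E G) (chartOne E G, chartOne E G)).comp
        (ContinuousLinearMap.inl ℝ E E)) (chartOne E G) :=
    ((contDiffAt_chartMul_left chartOne_mem_target).differentiableAt (by simp)).hasFDerivAt.comp
      (f := fun y : E => (y, chartOne E G)) _
      (hasFDerivAt_prodMk_left (chartOne E G) (chartOne E G))
  have h2 : (fun y => chartMul E G (y, chartOne E G)) =ᶠ[𝓝 (chartOne E G)] id := by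
    filter_upwards [extChartAt_target_mem_nhds_chartOne (G := G)] with y hy
    simp only [chartMul, extChartAt_symm_chartOne, mul_one, id]
    exact (extChartAt 𝓘(ℝ, E) (1 : G)).right_inv hy
  exact congrArg (fun A : E →L[ℝ] E => A v)
    (h1.unique ((hasFDerivAt_id _).congr_of_eventuallyEq h2))

variable (E G) in
/-- The second derivative of the multiplication at the identity, in the chart. -/
noncomputable def chartMulSnd : E × E →L[ℝ] E × E →L[ℝ] E :=
  fderiv ℝ (fderiv ℝ (chartMul E G)) (chartOne E G, chartOne E G)

theorem contDiffAt_fderiv_chartMul {x : E} (hx : x ∈ (extChartAt 𝓘(ℝ, E) (1 : G)).target) :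
    ContDiffAt ℝ ∞ (fderiv ℝ (chartMul E G)) (x, chartOne E G) :=
  (contDiffAt_chartMul_left hx).fderiv_right (by simp)

theorem hasFDerivAt_fderiv_chartMul :
    HasFDerivAt (fderiv ℝ (chartMul E G)) (chartMulSnd E G) (chartOne E G, chartOne E G) :=
  ((contDiffAt_fderiv_chartMul (E := E) (G := G) chartOne_mem_target).differentiableAt
    (by simp)).hasFDerivAt

theorem chartMulSnd_symm (p q : E × E) : chartMulSnd E G p q = chartMulSnd E G q p :=
  (contDiffAt_chartMul_left (E := E) (G := G) chartOne_mem_target).isSymmSndFDerivAt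
    (by rw [minSmoothness_of_isRCLikeNormedField]; exact WithTop.coe_le_coe.mpr le_top) p q

theorem hasFDerivAt_chartLeft (u : E) : HasFDerivAt (fun x => chartLeft E G x u)
    (((chartMulSnd E G).flip (0, u)).comp (ContinuousLinearMap.inl ℝ E E)) (chartOne E G) := by
  have h1 := (hasFDerivAt_fderiv_chartMul (E := E) (G := G)).comp
    (f := fun y : E => (y, chartOne E G)) (chartOne E G)
    (hasFDerivAt_prodMk_left (𝕜 := ℝ) (chartOne E G) (chartOne E G))
  have h2 := h1.clm_apply (hasFDerivAt_const ((0 : E), u) (chartOne E G))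
  refine h2.congr_fderiv ?_
  ext y
  simp

theorem hasFDerivAt_chartRight (v : E) : HasFDerivAt (fun x => chartRight E G x v)
    (((chartMulSnd E G).flip (v, 0)).comp (ContinuousLinearMap.inr ℝ E E)) (chartOne E G) := by
  have h1 := (hasFDerivAt_fderiv_chartMul (E := E) (G := G)).comp (chartOne E G)
    (hasFDerivAt_prodMk_right (𝕜 := ℝ) (chartOne E G) (chartOne E G))
  have h2 := h1.clm_apply (hasFDerivAt_const (v, (0 : E)) (chartOne E G))
  refine h2.congr_fderiv ?_
  ext y
  simp

/-- In the chart at the identity the Lie bracket is the antisymmetrization of the mixed part of the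
second derivative of the multiplication. -/
theorem lie_eq_chartMulSnd [CompleteSpace E] (u v : GroupLieAlgebra 𝓘(ℝ, E) G) :
    (⁅u, v⁆ : GroupLieAlgebra 𝓘(ℝ, E) G) =
      (chartMulSnd E G ((u : E), 0) (0, (v : E)) -
        chartMulSnd E G ((v : E), 0) (0, (u : E)) : E) := by
  have : IsManifold 𝓘(ℝ, E) 1 G := IsManifold.of_le (n := ∞) (by simp)
  have key : ∀ w : GroupLieAlgebra 𝓘(ℝ, E) G,
      mpullbackWithin 𝓘(ℝ, E) 𝓘(ℝ, E) (extChartAt 𝓘(ℝ, E) (1 : G)).symm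
        (mulInvariantVectorField w) (range 𝓘(ℝ, E)) =ᶠ[𝓝 (chartOne E G)]
      (fun x => chartLeft E G x w) := by
    intro w
    filter_upwards [extChartAt_target_mem_nhds_chartOne (G := G)] with x hx
    have hs := (extChartAt 𝓘(ℝ, E) (1 : G)).map_target hx
    have h1 := mfderiv_extChartAt_mulInvariantVectorField hs w
    rw [(extChartAt 𝓘(ℝ, E) (1 : G)).right_inv hx] at h1
    rw [mpullbackWithin_apply, ← h1]
    have h2 := mfderiv_extChartAt_comp_mfderivWithin_extChartAt_symm (I := 𝓘(ℝ, E)) hx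
    have h3 := mfderivWithin_extChartAt_symm_comp_mfderiv_extChartAt (I := 𝓘(ℝ, E)) hx
    rw [ContinuousLinearMap.inverse_eq h3 h2]
  have h4 : ∀ (u v : E) (A B : E → E), A =ᶠ[𝓝 (chartOne E G)] (fun x => chartLeft E G x u) →
      B =ᶠ[𝓝 (chartOne E G)] (fun x => chartLeft E G x v) → ∀ s : Set E, s = univ →
      lieBracketWithin ℝ A B s (chartOne E G) =
        chartMulSnd E G (u, 0) (0, v) - chartMulSnd E G (v, 0) (0, u) := by
    rintro u v A B hA hB s rfl
    rw [lieBracketWithin_univ, hA.lieBracket_vectorField_eq hB, lieBracket,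
      (hasFDerivAt_chartLeft (G := G) (E := E) u).fderiv,
      (hasFDerivAt_chartLeft (G := G) (E := E) v).fderiv, chartLeft_chartOne, chartLeft_chartOne]
    rfl
  have h5 : (mfderiv 𝓘(ℝ, E) 𝓘(ℝ, E) (extChartAt 𝓘(ℝ, E) (1 : G)) 1).inverse =
      ContinuousLinearMap.id ℝ E := by
    rw [mfderiv_extChartAt_self]
    exact ContinuousLinearMap.inverse_id
  exact (congrArg (fun A : E →L[ℝ] E => A _) h5).trans (h4 u v _ _ (key u) (key v) _
    (by rw [preimage_univ, univ_inter, ModelWithCorners.range_eq_univ]))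
end Chart

/-! ### Curves in a Lie group and their velocities -/

section ModelDeriv

variable {E₁ E₂ E₃ : Type*} [NormedAddCommGroup E₁] [NormedSpace ℝ E₁] [NormedAddCommGroup E₂]
  [NormedSpace ℝ E₂] [NormedAddCommGroup E₃] [NormedSpace ℝ E₃]
  {M₁ M₂ M₃ : Type*} [TopologicalSpace M₁] [ChartedSpace E₁ M₁] [TopologicalSpace M₂]
  [ChartedSpace E₂ M₂] [TopologicalSpace M₃] [ChartedSpace E₃ M₃]

/-- `f` has the derivative `A` at `x`, where `A` is typed as a map between the model spaces, which
underlie all tangent spaces. -/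
def HasModelDerivAt (f : M₁ → M₂) (A : E₁ →L[ℝ] E₂) (x : M₁) : Prop :=
  HasMFDerivAt 𝓘(ℝ, E₁) 𝓘(ℝ, E₂) f x A

namespace HasModelDerivAt

theorem comp {g : M₂ → M₃} {f : M₁ → M₂} {y : M₂} {x : M₁} {B : E₂ →L[ℝ] E₃} {A : E₁ →L[ℝ] E₂}
    (hg : HasModelDerivAt g B y) (hf : HasModelDerivAt f A x) (h : f x = y) :
    HasModelDerivAt (fun z => g (f z)) (B.comp A) x :=
  HasMFDerivAt.comp_of_eq hg hf h

theorem congr_of_eventuallyEq {f f₁ : M₁ → M₂} {A : E₁ →L[ℝ] E₂} {x : M₁}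
    (h : HasModelDerivAt f A x) (h₁ : f₁ =ᶠ[𝓝 x] f) : HasModelDerivAt f₁ A x :=
  HasMFDerivAt.congr_of_eventuallyEq (f := f) h h₁

theorem unique {f : M₁ → M₂} {A B : E₁ →L[ℝ] E₂} {x : M₁} (hA : HasModelDerivAt f A x)
    (hB : HasModelDerivAt f B x) : A = B :=
  hasMFDerivAt_unique hA hB

theorem continuousAt {f : M₁ → M₂} {A : E₁ →L[ℝ] E₂} {x : M₁} (h : HasModelDerivAt f A x) :
    ContinuousAt f x :=
  HasMFDerivAt.continuousAt h

theorem mdifferentiableAt {f : M₁ → M₂} {A : E₁ →L[ℝ] E₂} {x : M₁} (h : HasModelDerivAt f A x) :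
    MDifferentiableAt 𝓘(ℝ, E₁) 𝓘(ℝ, E₂) f x :=
  HasMFDerivAt.mdifferentiableAt h

theorem exists_of_mdifferentiableAt {f : M₁ → M₂} {x : M₁}
    (h : MDifferentiableAt 𝓘(ℝ, E₁) 𝓘(ℝ, E₂) f x) :
    ∃ A : E₁ →L[ℝ] E₂, HasModelDerivAt f A x := by
  let A : E₁ →L[ℝ] E₂ := mfderiv 𝓘(ℝ, E₁) 𝓘(ℝ, E₂) f x
  exact ⟨A, h.hasMFDerivAt⟩

theorem of_hasFDerivAt {f : E₁ → E₂} {A : E₁ →L[ℝ] E₂} {x : E₁} (h : HasFDerivAt f A x) :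
    HasModelDerivAt f A x :=
  h.hasMFDerivAt

theorem hasFDerivAt {f : E₁ → E₂} {A : E₁ →L[ℝ] E₂} {x : E₁} (h : HasModelDerivAt f A x) :
    HasFDerivAt f A x :=
  HasMFDerivAt.hasFDerivAt h

theorem id (x : M₁) : HasModelDerivAt (fun y : M₁ => y) (ContinuousLinearMap.id ℝ E₁) x :=
  hasMFDerivAt_id _

end HasModelDerivAt

end ModelDeriv

section Curves
variable {E : Type*} [NormedAddCommGroup E] [NormedSpace ℝ E]
  {G : Type*} [TopologicalSpace G] [ChartedSpace E G]

/-- The curve `γ` has velocity `v` at time `t`. -/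
def HasVelocityAt (γ : ℝ → G) (v : E) (t : ℝ) : Prop :=
  HasModelDerivAt γ (ContinuousLinearMap.toSpanSingleton ℝ v) t

theorem HasModelDerivAt.hasVelocityAt {γ : ℝ → G} {A : ℝ →L[ℝ] E} {t : ℝ}
    (h : HasModelDerivAt γ A t) : HasVelocityAt γ (A 1) t := by
  have : ContinuousLinearMap.toSpanSingleton ℝ (A 1) = A := by ext; simp
  rwa [HasVelocityAt, this]

theorem HasVelocityAt.continuousAt {γ : ℝ → G} {v : E} {t : ℝ} (h : HasVelocityAt γ v t) :
    ContinuousAt γ t :=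
  HasModelDerivAt.continuousAt h

theorem HasVelocityAt.congr_of_eventuallyEq {γ γ₁ : ℝ → G} {v : E} {t : ℝ}
    (h : HasVelocityAt γ v t) (h₁ : γ₁ =ᶠ[𝓝 t] γ) : HasVelocityAt γ₁ v t :=
  HasModelDerivAt.congr_of_eventuallyEq h h₁

theorem HasVelocityAt.unique {γ : ℝ → G} {v w : E} {t : ℝ} (hv : HasVelocityAt γ v t)
    (hw : HasVelocityAt γ w t) : v = w := by
  simpa using congrArg (fun A : ℝ →L[ℝ] E => A 1) (HasModelDerivAt.unique hv hw)

theorem MDifferentiableAt.exists_hasVelocityAt {γ : ℝ → G} {t : ℝ}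
    (h : MDifferentiableAt 𝓘(ℝ, ℝ) 𝓘(ℝ, E) γ t) : ∃ v : E, HasVelocityAt γ v t :=
  let ⟨_, hA⟩ := HasModelDerivAt.exists_of_mdifferentiableAt h
  ⟨_, hA.hasVelocityAt⟩

theorem HasModelDerivAt.comp_hasVelocityAt {E₁ M : Type*} [NormedAddCommGroup E₁]
    [NormedSpace ℝ E₁] [TopologicalSpace M] [ChartedSpace E₁ M] {f : G → M} {A : E →L[ℝ] E₁}
    {γ : ℝ → G} {v : E} {t : ℝ} (hf : HasModelDerivAt f A (γ t)) (h : HasVelocityAt γ v t) :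
    HasVelocityAt (fun s => f (γ s)) (A v) t := by
  simpa using (hf.comp h rfl).hasVelocityAt

theorem hasVelocityAt_iff_hasDerivAt {γ : ℝ → E} {v : E} {t : ℝ} :
    HasVelocityAt γ v t ↔ HasDerivAt γ v t :=
  ⟨fun h => HasModelDerivAt.hasFDerivAt h, fun h => HasModelDerivAt.of_hasFDerivAt h⟩

theorem HasVelocityAt.comp_mul {γ : ℝ → G} {v : E} (c : ℝ) {t : ℝ}
    (h : HasVelocityAt γ v (c * t)) : HasVelocityAt (fun s => γ (c * s)) (c • v) t := by
  have h1 : HasDerivAt (fun s => c * s) c t := by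
    simpa using (hasDerivAt_id' t).const_mul c
  have h2 := HasModelDerivAt.comp_hasVelocityAt h (hasVelocityAt_iff_hasDerivAt.mpr h1)
  simpa using h2

/-- A curve with vanishing velocity is constant. -/
theorem eqOn_of_hasVelocityAt_zero [T2Space G] [IsManifold 𝓘(ℝ, E) ∞ G] [CompleteSpace E]
    {γ : ℝ → G} {a b : ℝ} (h : ∀ t ∈ Ioo a b, HasVelocityAt γ (0 : E) t) {s t : ℝ}
    (hs : s ∈ Ioo a b) (ht : t ∈ Ioo a b) : γ s = γ t := by
  have : IsManifold 𝓘(ℝ, E) 1 G := IsManifold.of_le (n := ∞) (by simp)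
  have hv : ContMDiff 𝓘(ℝ, E) 𝓘(ℝ, E).tangent 1
      (fun y : G => (⟨y, 0⟩ : TangentBundle 𝓘(ℝ, E) G)) := Bundle.contMDiff_zeroSection ℝ _
  have h1 : IsMIntegralCurveOn (I := 𝓘(ℝ, E)) γ (fun _ => 0) (Ioo a b) := fun r hr => by
    have h3 : ContinuousLinearMap.toSpanSingleton ℝ (0 : E) =
      (1 : ℝ →L[ℝ] ℝ).smulRight (0 : E) := by ext; simp
    have h2 := h r hr
    rw [HasVelocityAt, h3] at h2
    exact HasMFDerivAt.hasMFDerivWithinAt h2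
  have h4 : IsMIntegralCurveOn (I := 𝓘(ℝ, E)) (fun _ => γ t) (fun _ : G => 0) (Ioo a b) :=
    fun r hr => by
    have h2 : HasModelDerivAt (fun _ : ℝ => γ t) (0 : ℝ →L[ℝ] E) r := hasMFDerivAt_const _ _
    have h3 : (0 : ℝ →L[ℝ] E) =
      (1 : ℝ →L[ℝ] ℝ).smulRight (0 : E) := by ext; simp
    rw [h3] at h2
    exact HasMFDerivAt.hasMFDerivWithinAt h2
  exact isMIntegralCurveOn_Ioo_eqOn_of_contMDiff_boundaryless ht hv h1 h4 rfl hs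

variable [Group G]

/-- The derivative at `b` of left multiplication by `a`. -/
noncomputable def leftD (a b : G) : E →L[ℝ] E := mfderiv 𝓘(ℝ, E) 𝓘(ℝ, E) (fun x : G => a * x) b

/-- The derivative at `b` of right multiplication by `a`. -/
noncomputable def rightD (a b : G) : E →L[ℝ] E := mfderiv 𝓘(ℝ, E) 𝓘(ℝ, E) (fun x : G => x * a) b

variable [LieGroup 𝓘(ℝ, E) ∞ G]

theorem hasModelDerivAt_leftD (a b : G) :
    HasModelDerivAt (fun x : G => a * x) (leftD (E := E) a b) b :=
  hasMFDerivAt_mul_left a b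

theorem hasModelDerivAt_rightD (a b : G) :
    HasModelDerivAt (fun x : G => x * a) (rightD (E := E) a b) b :=
  hasMFDerivAt_mul_right a b

theorem leftD_comp_leftD (a c b : G) :
    (leftD (E := E) a (c * b)).comp (leftD c b) = leftD (a * c) b := by
  have h := HasModelDerivAt.comp (hasModelDerivAt_leftD (E := E) a (c * b))
    (hasModelDerivAt_leftD (E := E) c b) rfl
  simp only [← mul_assoc] at h
  exact HasModelDerivAt.unique h (hasModelDerivAt_leftD (E := E) (a * c) b)

theorem rightD_comp_rightD (a c b : G) :
    (rightD (E := E) a (b * c)).comp (rightD c b) = rightD (c * a) b := by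
  have h := HasModelDerivAt.comp (hasModelDerivAt_rightD (E := E) a (b * c))
    (hasModelDerivAt_rightD (E := E) c b) rfl
  simp only [mul_assoc] at h
  exact HasModelDerivAt.unique h (hasModelDerivAt_rightD (E := E) (c * a) b)

theorem leftD_comp_rightD (a c b : G) :
    (leftD (E := E) a (b * c)).comp (rightD c b) = (rightD c (a * b)).comp (leftD a b) := by
  have h1 := HasModelDerivAt.comp (hasModelDerivAt_leftD (E := E) a (b * c))
    (hasModelDerivAt_rightD (E := E) c b) rfl
  have h2 := HasModelDerivAt.comp (hasModelDerivAt_rightD (E := E) c (a * b))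
    (hasModelDerivAt_leftD (E := E) a b) rfl
  simp only [mul_assoc] at h1 h2
  exact HasModelDerivAt.unique h1 h2

theorem leftD_one (b : G) : leftD (E := E) 1 b = ContinuousLinearMap.id ℝ E := by
  have h := hasModelDerivAt_leftD (E := E) (1 : G) b
  simp only [one_mul] at h
  exact HasModelDerivAt.unique h (HasModelDerivAt.id _)

theorem rightD_one (b : G) : rightD (E := E) 1 b = ContinuousLinearMap.id ℝ E := by
  have h := hasModelDerivAt_rightD (E := E) (1 : G) b
  simp only [mul_one] at h
  exact HasModelDerivAt.unique h (HasModelDerivAt.id _)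

theorem leftD_bijective (a b : G) : Function.Bijective (leftD (E := E) a b) := by
  have h1 := leftD_comp_leftD (E := E) a⁻¹ a b
  have h2 := leftD_comp_leftD (E := E) a a⁻¹ (a * b)
  rw [inv_mul_cancel, leftD_one] at h1
  rw [mul_inv_cancel, leftD_one, inv_mul_cancel_left] at h2
  exact Function.bijective_iff_has_inverse.mpr ⟨leftD a⁻¹ (a * b),
    fun x => congrArg (fun A : E →L[ℝ] E => A x) h1,
    fun x => congrArg (fun A : E →L[ℝ] E => A x) h2⟩

theorem rightD_injective (a b : G) : Function.Injective (rightD (E := E) a b) := by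
  have h1 := rightD_comp_rightD (E := E) a⁻¹ a b
  rw [mul_inv_cancel, rightD_one] at h1
  exact Function.LeftInverse.injective (g := rightD (E := E) a⁻¹ (b * a))
    fun x => congrArg (fun A : E →L[ℝ] E => A x) h1

theorem HasVelocityAt.mul {α β : ℝ → G} {v w : E} {t : ℝ} (hα : HasVelocityAt α v t)
    (hβ : HasVelocityAt β w t) :
    HasVelocityAt (fun s => α s * β s) (rightD (β t) (α t) v + leftD (α t) (β t) w) t := by
  have hm : MDifferentiableAt (𝓘(ℝ, E).prod 𝓘(ℝ, E)) 𝓘(ℝ, E) (fun p : G × G => p.1 * p.2)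
      (α t, β t) := (contMDiff_mul 𝓘(ℝ, E) ∞).mdifferentiableAt (by simp)
  let D : E × E →L[ℝ] E :=
    mfderiv (𝓘(ℝ, E).prod 𝓘(ℝ, E)) 𝓘(ℝ, E) (fun p : G × G => p.1 * p.2) (α t, β t)
  have h : HasModelDerivAt (fun s => α s * β s)
      (D.comp ((ContinuousLinearMap.toSpanSingleton ℝ v).prod
        (ContinuousLinearMap.toSpanSingleton ℝ w))) t :=
    HasMFDerivAt.comp t (g := fun p : G × G => p.1 * p.2) hm.hasMFDerivAt
      (HasMFDerivAt.prodMk hα hβ)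
  have h1 : D (v, w) = rightD (β t) (α t) v + leftD (α t) (β t) w := mfderiv_prod_eq_add_apply hm
  rw [← h1]
  simpa using h.hasVelocityAt

theorem HasVelocityAt.const_mul {β : ℝ → G} {w : E} {t : ℝ} (a : G) (hβ : HasVelocityAt β w t) :
    HasVelocityAt (fun s => a * β s) (leftD a (β t) w) t :=
  (hasModelDerivAt_leftD a (β t)).comp_hasVelocityAt hβ

theorem HasVelocityAt.mdifferentiableAt_mul_inv {α β : ℝ → G} {v w : E} {t : ℝ}
    (hα : HasVelocityAt α v t) (hβ : HasVelocityAt β w t) :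
    MDifferentiableAt 𝓘(ℝ, ℝ) 𝓘(ℝ, E) (fun s => α s * (β s)⁻¹) t := by
  have h1 : MDifferentiableAt 𝓘(ℝ, ℝ) 𝓘(ℝ, E) (fun s => (β s)⁻¹) t :=
    ((contMDiff_inv 𝓘(ℝ, E) ∞).mdifferentiableAt (by simp)).comp t
      (HasMFDerivAt.mdifferentiableAt hβ)
  have hm : MDifferentiableAt (𝓘(ℝ, E).prod 𝓘(ℝ, E)) 𝓘(ℝ, E) (fun p : G × G => p.1 * p.2)
      (α t, (β t)⁻¹) := (contMDiff_mul 𝓘(ℝ, E) ∞).mdifferentiableAt (by simp)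
  exact hm.comp t (f := fun s => (α s, (β s)⁻¹)) ((HasMFDerivAt.mdifferentiableAt hα).prodMk h1)

theorem HasVelocityAt.mdifferentiableAt_inv_mul {α β : ℝ → G} {v w : E} {t : ℝ}
    (hα : HasVelocityAt α v t) (hβ : HasVelocityAt β w t) :
    MDifferentiableAt 𝓘(ℝ, ℝ) 𝓘(ℝ, E) (fun s => (α s)⁻¹ * β s) t := by
  have h1 : MDifferentiableAt 𝓘(ℝ, ℝ) 𝓘(ℝ, E) (fun s => (α s)⁻¹) t :=
    ((contMDiff_inv 𝓘(ℝ, E) ∞).mdifferentiableAt (by simp)).comp t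
      (HasMFDerivAt.mdifferentiableAt hα)
  have hm : MDifferentiableAt (𝓘(ℝ, E).prod 𝓘(ℝ, E)) 𝓘(ℝ, E) (fun p : G × G => p.1 * p.2)
      ((α t)⁻¹, β t) := (contMDiff_mul 𝓘(ℝ, E) ∞).mdifferentiableAt (by simp)
  exact hm.comp t (f := fun s => ((α s)⁻¹, β s)) (h1.prodMk (HasMFDerivAt.mdifferentiableAt hβ))

/-- `γ` solves `γ' = γ u` at time `t`: its velocity there is the left translate of `u t`. -/
def IsLiftAt (γ : ℝ → G) (u : ℝ → E) (t : ℝ) : Prop := HasVelocityAt γ (leftD (γ t) 1 (u t)) t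

/-- The equation `γ' = γ u` is invariant under left translations. -/
theorem IsLiftAt.const_mul {γ : ℝ → G} {u : ℝ → E} {t : ℝ} (a : G) (h : IsLiftAt γ u t) :
    IsLiftAt (fun s => a * γ s) u t := by
  have h1 := HasVelocityAt.const_mul a h
  have h2 := leftD_comp_leftD (E := E) a (γ t) 1
  rw [mul_one] at h2
  have h3 := congrArg (fun A : E →L[ℝ] E => A (u t)) h2
  change HasVelocityAt _ (leftD (a * γ t) 1 (u t)) t
  rw [← show leftD a (γ t) (leftD (γ t) 1 (u t)) = leftD (a * γ t) 1 (u t) from h3]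
  exact h1

omit [LieGroup 𝓘(ℝ, E) ∞ G] in
theorem IsLiftAt.congr_of_eventuallyEq {γ γ₁ : ℝ → G} {u : ℝ → E} {t : ℝ} (h : IsLiftAt γ u t)
    (h₁ : γ₁ =ᶠ[𝓝 t] γ) : IsLiftAt γ₁ u t := by
  rw [IsLiftAt, h₁.self_of_nhds]
  exact HasVelocityAt.congr_of_eventuallyEq h h₁

/-- Two solutions of `γ' = γ u` differ by a constant left factor, because `γ₁ γ₂⁻¹` has vanishing
velocity. -/
theorem IsLiftAt.eqOn [T2Space G] [CompleteSpace E] {γ₁ γ₂ : ℝ → G} {u : ℝ → E} {a b : ℝ}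
    (h₁ : ∀ t ∈ Ioo a b, IsLiftAt γ₁ u t) (h₂ : ∀ t ∈ Ioo a b, IsLiftAt γ₂ u t) {s : ℝ}
    (hs : s ∈ Ioo a b) (h : γ₁ s = γ₂ s) : EqOn γ₁ γ₂ (Ioo a b) := by
  have hk : ∀ t ∈ Ioo a b, HasVelocityAt (fun r => γ₁ r * (γ₂ r)⁻¹) (0 : E) t := by
    intro t ht
    obtain ⟨κ, hκ⟩ := (HasVelocityAt.mdifferentiableAt_mul_inv (h₁ t ht)
      (h₂ t ht)).exists_hasVelocityAt
    have h3 := HasVelocityAt.mul hκ (h₂ t ht)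
    simp only [inv_mul_cancel_right] at h3
    have h4 := HasVelocityAt.unique h3 (h₁ t ht)
    have h5 := leftD_comp_leftD (E := E) (γ₁ t * (γ₂ t)⁻¹) (γ₂ t) 1
    rw [mul_one, inv_mul_cancel_right] at h5
    have h6 := congrArg (fun A : E →L[ℝ] E => A (u t)) h5
    simp only [ContinuousLinearMap.comp_apply] at h6
    rw [h6] at h4
    have h7 : κ = 0 := rightD_injective _ _ ((add_eq_right.mp h4).trans (map_zero _).symm)
    rwa [h7] at hκ
  intro t ht
  have := eqOn_of_hasVelocityAt_zero hk ht hs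
  simp only [h, mul_inv_cancel] at this
  exact mul_inv_eq_one.mp this

end Curves

/-! ### The equation `γ' = γ u` -/

section Lift
variable {E : Type*} [NormedAddCommGroup E] [NormedSpace ℝ E]
  {G : Type*} [TopologicalSpace G] [ChartedSpace E G] [Group G] [LieGroup 𝓘(ℝ, E) ∞ G]

theorem hasModelDerivAt_extChartAt_symm_chartLeft {x : E}
    (hx : x ∈ (extChartAt 𝓘(ℝ, E) (1 : G)).target) :
    ∃ A : E →L[ℝ] E, HasModelDerivAt (extChartAt 𝓘(ℝ, E) (1 : G)).symm A x ∧
      ∀ u, A (chartLeft E G x u) = leftD ((extChartAt 𝓘(ℝ, E) (1 : G)).symm x) 1 u := by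
  have : IsManifold 𝓘(ℝ, E) 1 G := IsManifold.of_le (n := ∞) (by simp)
  let A : E →L[ℝ] E := mfderivWithin 𝓘(ℝ, E) 𝓘(ℝ, E) (extChartAt 𝓘(ℝ, E) (1 : G)).symm
    (range 𝓘(ℝ, E)) x
  have h1 := (mdifferentiableWithinAt_extChartAt_symm (I := 𝓘(ℝ, E)) hx).hasMFDerivWithinAt
  have h2 : HasModelDerivAt (extChartAt 𝓘(ℝ, E) (1 : G)).symm A x :=
    hasMFDerivWithinAt_univ.mp (h1.mono (by rw [ModelWithCorners.range_eq_univ]))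
  refine ⟨A, h2, fun u => ?_⟩
  have hs := (extChartAt 𝓘(ℝ, E) (1 : G)).map_target hx
  have h3 := mfderiv_extChartAt_mulInvariantVectorField hs u
  rw [(extChartAt 𝓘(ℝ, E) (1 : G)).right_inv hx] at h3
  have h4 := mfderivWithin_extChartAt_symm_comp_mfderiv_extChartAt (I := 𝓘(ℝ, E)) hx
  rw [← h3]
  exact congrArg (fun B : E →L[ℝ] E => B (leftD ((extChartAt 𝓘(ℝ, E) (1 : G)).symm x) 1 u)) h4

theorem hasModelDerivAt_extChartAt {a : G} (ha : a ∈ (extChartAt 𝓘(ℝ, E) (1 : G)).source) :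
    ∃ A : E →L[ℝ] E, HasModelDerivAt (extChartAt 𝓘(ℝ, E) (1 : G)) A a ∧
      (∀ u, A (leftD a 1 u) = chartLeft E G (extChartAt 𝓘(ℝ, E) (1 : G) a) u) ∧
      ∀ v, A (rightD a 1 v) = chartRight E G (extChartAt 𝓘(ℝ, E) (1 : G) a) v := by
  have : IsManifold 𝓘(ℝ, E) 1 G := IsManifold.of_le (n := ∞) (by simp)
  let A : E →L[ℝ] E := mfderiv 𝓘(ℝ, E) 𝓘(ℝ, E) (extChartAt 𝓘(ℝ, E) (1 : G)) a
  have h1 : HasModelDerivAt (extChartAt 𝓘(ℝ, E) (1 : G)) A a :=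
    (mdifferentiableAt_extChartAt (by rwa [extChartAt_source] at ha)).hasMFDerivAt
  exact ⟨A, h1, fun u => mfderiv_extChartAt_mulInvariantVectorField ha u,
    fun v => mfderiv_extChartAt_mulRightInvariantVectorField ha v⟩

theorem contDiffAt_chartLeft_comp {F : Type*} [NormedAddCommGroup F] [NormedSpace ℝ F]
    {x : F → E} {u : F → E} {p : F} {n : ℕ∞} (hx : ContDiffAt ℝ n x p) (hu : ContDiffAt ℝ n u p)
    (hp : x p ∈ (extChartAt 𝓘(ℝ, E) (1 : G)).target) :
    ContDiffAt ℝ n (fun q => chartLeft E G (x q) (u q)) p := by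
  have hn : (n : WithTop ℕ∞) ≤ ∞ := WithTop.coe_le_coe.mpr le_top
  have h1 : ContDiffAt ℝ n (fun q => fderiv ℝ (chartMul E G) (x q, chartOne E G)) p :=
    ((contDiffAt_fderiv_chartMul hp).of_le hn).comp p (f := fun q => (x q, chartOne E G))
      (hx.prodMk contDiffAt_const)
  exact h1.clm_apply (contDiffAt_const.prodMk hu)

/-- Local solutions of `γ' = γ u`: in the chart at the identity this is the equation
`x' = chartLeft x (u t)`, made autonomous by adding the time to the unknowns. -/
theorem exists_isLiftAt_Ioo [CompleteSpace E] {u : ℝ → E} (hu : ContDiff ℝ 1 u) (t₀ : ℝ) :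
    ∃ γ : ℝ → G, ∃ ε > 0, ∀ t ∈ Ioo (t₀ - ε) (t₀ + ε), IsLiftAt γ u t := by
  set V : E × ℝ → E × ℝ := fun q => (chartLeft E G q.1 (u q.2), 1) with hV
  have hVc : ContDiffAt ℝ 1 V (chartOne E G, t₀) :=
    (contDiffAt_chartLeft_comp (n := 1) contDiffAt_fst
      (hu.contDiffAt.comp (chartOne E G, t₀) contDiffAt_snd) chartOne_mem_target).prodMk
      contDiffAt_const
  obtain ⟨α, hα0, ε, hε, hα⟩ :=
    hVc.exists_forall_mem_closedBall_exists_eq_forall_mem_Ioo_hasDerivAt₀ t₀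
  have ht₀ : t₀ ∈ Ioo (t₀ - ε) (t₀ + ε) := ⟨by linarith, by linarith⟩
  have hsnd : ∀ t ∈ Ioo (t₀ - ε) (t₀ + ε), (α t).2 = t := by
    intro t ht
    have hd : ∀ s ∈ Ioo (t₀ - ε) (t₀ + ε), HasDerivAt (fun r => (α r).2 - r) 0 s := by
      intro s hs
      have h1 : HasDerivAt (fun r => (α r).2) 1 s :=
        (ContinuousLinearMap.snd ℝ E ℝ).hasFDerivAt.comp_hasDerivAt s (hα s hs)
      simpa using h1.fun_sub (hasDerivAt_id' s)
    have := isOpen_Ioo.is_const_of_deriv_eq_zero isPreconnected_Ioo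
      (fun s hs => (hd s hs).differentiableAt.differentiableWithinAt)
      (fun s hs => (hd s hs).deriv) ht ht₀
    simp only [hα0, sub_self] at this
    linarith
  have htarget : ∀ᶠ t in 𝓝 t₀, (α t).1 ∈ (extChartAt 𝓘(ℝ, E) (1 : G)).target := by
    refine (hα t₀ ht₀).continuousAt.fst.eventually ?_
    simp only [hα0]
    exact extChartAt_target_mem_nhds_chartOne
  obtain ⟨δ, hδ, hball⟩ := Metric.eventually_nhds_iff_ball.mp htarget
  refine ⟨fun t => (extChartAt 𝓘(ℝ, E) (1 : G)).symm (α t).1, min ε δ, lt_min hε hδ,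
    fun t ht => ?_⟩
  have hδt : t ∈ Metric.ball t₀ δ := by
    rw [Real.ball_eq_Ioo]
    exact ⟨by linarith [ht.1, min_le_right ε δ], by linarith [ht.2, min_le_right ε δ]⟩
  have hεt : t ∈ Ioo (t₀ - ε) (t₀ + ε) :=
    ⟨by linarith [ht.1, min_le_left ε δ], by linarith [ht.2, min_le_left ε δ]⟩
  obtain ⟨A, hA, hAu⟩ := hasModelDerivAt_extChartAt_symm_chartLeft (hball t hδt)
  have h1 : HasDerivAt (fun s => (α s).1) (chartLeft E G (α t).1 (u t)) t := by
    have h3 : HasDerivAt (fun s => (α s).1) (chartLeft E G (α t).1 (u (α t).2)) t :=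
      (ContinuousLinearMap.fst ℝ E ℝ).hasFDerivAt.comp_hasDerivAt t (hα t hεt)
    rwa [hsnd t hεt] at h3
  have h2 := hA.comp_hasVelocityAt (hasVelocityAt_iff_hasDerivAt.mpr h1)
  rw [hAu] at h2
  exact h2

/-- Two solutions on overlapping intervals can be glued, after a left translation of one of them. -/
theorem exists_isLiftAt_union [T2Space G] [CompleteSpace E] {u : ℝ → E} {a b c d t₀ : ℝ}
    {γ h : ℝ → G} (hγ : ∀ t ∈ Ioo a b, IsLiftAt γ u t) (hh : ∀ t ∈ Ioo c d, IsLiftAt h u t)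
    (h₁ : t₀ ∈ Ioo a b) (h₂ : t₀ ∈ Ioo c d) :
    ∃ γ₁ : ℝ → G, ∀ t ∈ Ioo a d, IsLiftAt γ₁ u t := by
  classical
  set h' : ℝ → G := fun t => γ t₀ * (h t₀)⁻¹ * h t with hh'
  have hl : ∀ t ∈ Ioo c d, IsLiftAt h' u t := fun t ht => (hh t ht).const_mul _
  have heq : EqOn γ h' (Ioo (max a c) (min b d)) :=
    IsLiftAt.eqOn (u := u) (s := t₀)
      (fun t ht => hγ t ⟨(le_max_left _ _).trans_lt ht.1, ht.2.trans_le (min_le_left _ _)⟩)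
      (fun t ht => hl t ⟨(le_max_right _ _).trans_lt ht.1, ht.2.trans_le (min_le_right _ _)⟩)
      ⟨max_lt h₁.1 h₂.1, lt_min h₁.2 h₂.2⟩ (by simp [hh'])
  refine ⟨fun t => if t ≤ t₀ then γ t else h' t, fun t ht => ?_⟩
  rcases lt_trichotomy t t₀ with hlt | rfl | hgt
  · refine (hγ t ⟨ht.1, hlt.trans h₁.2⟩).congr_of_eventuallyEq ?_
    filter_upwards [Iio_mem_nhds hlt] with s hs
    rw [if_pos (le_of_lt hs)]
  · refine (hγ t h₁).congr_of_eventuallyEq ?_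
    filter_upwards [Ioo_mem_nhds (max_lt h₁.1 h₂.1) (lt_min h₁.2 h₂.2)] with s hs
    split_ifs
    · rfl
    · exact (heq hs).symm
  · refine (hl t ⟨h₂.1.trans hgt, ht.2⟩).congr_of_eventuallyEq ?_
    filter_upwards [Ioi_mem_nhds hgt] with s hs
    rw [if_neg (not_le.mpr hs)]

/-- `γ' = γ u` is solvable on a neighbourhood of any compact interval: left translates of local
solutions are joined along a finite subdivision. -/
theorem exists_isLiftAt_Ioo_of_le [T2Space G] [CompleteSpace E] {u : ℝ → E} (hu : ContDiff ℝ 1 u)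
    {a b : ℝ} (hab : a ≤ b) :
    ∃ γ : ℝ → G, ∃ a' < a, ∃ b' > b, ∀ t ∈ Ioo a' b', IsLiftAt γ u t := by
  choose γ ε hε hγ using fun t₀ => exists_isLiftAt_Ioo (G := G) hu t₀
  obtain ⟨t, ht0, hmono, ⟨m, hm⟩, hsub⟩ := exists_monotone_Icc_subset_open_cover_Icc hab
    (c := fun t₀ : ℝ => Subtype.val ⁻¹' Ioo (t₀ - ε t₀) (t₀ + ε t₀))
    (fun t₀ => isOpen_Ioo.preimage continuous_subtype_val)
    (fun s _ => mem_iUnion.mpr ⟨s, by constructor <;> linarith [hε s]⟩)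
  have key : ∀ n, ∃ γ : ℝ → G, ∃ a' < a, ∃ b' > (t n : ℝ), ∀ s ∈ Ioo a' b', IsLiftAt γ u s := by
    intro n
    induction n with
    | zero =>
      refine ⟨γ a, a - ε a, by linarith [hε a], a + ε a, ?_, hγ a⟩
      rw [ht0]
      linarith [hε a]
    | succ n ih =>
      obtain ⟨η, a', ha', b', hb', hη⟩ := ih
      obtain ⟨i, hi⟩ := hsub n
      have hle := hmono n.le_succ
      have h1 := hi ⟨le_rfl, hle⟩
      have h2 := hi ⟨hle, le_rfl⟩
      obtain ⟨γ₁, hγ₁⟩ := exists_isLiftAt_union hη (hγ i) (t₀ := t n)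
        ⟨ha'.trans_le (t n).2.1, hb'⟩ h1
      exact ⟨γ₁, a', ha', _, h2.2, hγ₁⟩
  obtain ⟨η, a', ha', b', hb', hη⟩ := key m
  rw [hm m le_rfl] at hb'
  exact ⟨η, a', ha', b', hb', hη⟩

/-- Global solvability of `γ' = γ u`: solutions on the intervals `(-T, T)` agree by uniqueness. -/
theorem exists_forall_isLiftAt [T2Space G] [CompleteSpace E] {u : ℝ → E} (hu : ContDiff ℝ 1 u) :
    ∃ γ : ℝ → G, γ 0 = 1 ∧ ∀ t, IsLiftAt γ u t := by
  have h : ∀ T : ℝ, ∃ γ : ℝ → G, γ 0 = 1 ∧ ∀ t ∈ Ioo (-T) T, IsLiftAt γ u t := by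
    intro T
    obtain ⟨γ, a', ha', b', hb', hγ⟩ := exists_isLiftAt_Ioo_of_le (G := G) hu
      (neg_le_self (abs_nonneg T))
    refine ⟨fun t => (γ 0)⁻¹ * γ t, by simp, fun t ht => (hγ t ⟨?_, ?_⟩).const_mul _⟩
    · linarith [ht.1, le_abs_self T]
    · linarith [ht.2, le_abs_self T]
  choose γ hγ0 hγ using h
  have heq : ∀ S T : ℝ, 0 < S → S ≤ T → EqOn (γ S) (γ T) (Ioo (-S) S) := fun S T hS hST =>
    IsLiftAt.eqOn (hγ S) (fun t ht => hγ T t ⟨by linarith [ht.1], by linarith [ht.2]⟩)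
      (s := 0) ⟨by linarith, hS⟩ (by rw [hγ0, hγ0])
  refine ⟨fun t => γ (|t| + 1) t, hγ0 _, fun t => ?_⟩
  have ht : t ∈ Ioo (-(|t| + 1)) (|t| + 1) := by
    constructor <;> linarith [neg_abs_le t, le_abs_self t]
  refine (hγ (|t| + 1) t ht).congr_of_eventuallyEq ?_
  filter_upwards [Ioo_mem_nhds ht.1 ht.2] with s hs
  have hs' : s ∈ Ioo (-(|s| + 1)) (|s| + 1) := by
    constructor <;> linarith [neg_abs_le s, le_abs_self s]
  rcases le_total (|s| + 1) (|t| + 1) with h | h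
  · exact heq _ _ (by positivity) h hs'
  · exact (heq _ _ (by positivity) h hs).symm

/-- If `γ₀' = γ₀ u₀` and `γ' = γ u`, then `h = γ₀⁻¹ γ` solves `h' = h u - u₀ h`. -/
theorem IsLiftAt.inv_mul {γ₀ γ : ℝ → G} {u₀ u : ℝ → E} {t : ℝ} (h₀ : IsLiftAt γ₀ u₀ t)
    (h : IsLiftAt γ u t) : HasVelocityAt (fun s => (γ₀ s)⁻¹ * γ s)
      (leftD ((γ₀ t)⁻¹ * γ t) 1 (u t) - rightD ((γ₀ t)⁻¹ * γ t) 1 (u₀ t)) t := by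
  obtain ⟨η, hη⟩ := (HasVelocityAt.mdifferentiableAt_inv_mul h₀ h).exists_hasVelocityAt
  have h3 := HasVelocityAt.mul h₀ hη
  simp only [mul_inv_cancel_left] at h3
  have h4 := HasVelocityAt.unique h3 h
  have h5 := leftD_comp_leftD (E := E) (γ₀ t) ((γ₀ t)⁻¹ * γ t) 1
  rw [mul_one, mul_inv_cancel_left] at h5
  have h6 := leftD_comp_rightD (E := E) (γ₀ t) ((γ₀ t)⁻¹ * γ t) 1
  rw [mul_one, one_mul] at h6
  have h7 := congrArg (fun A : E →L[ℝ] E => A (u t)) h5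
  have h8 := congrArg (fun A : E →L[ℝ] E => A (u₀ t)) h6
  simp only [ContinuousLinearMap.comp_apply] at h7 h8
  have h9 : η = leftD ((γ₀ t)⁻¹ * γ t) 1 (u t) - rightD ((γ₀ t)⁻¹ * γ t) 1 (u₀ t) := by
    apply (leftD_bijective (γ₀ t) ((γ₀ t)⁻¹ * γ t)).1
    rw [map_sub, h7, h8, ← h4]
    abel
  rwa [h9] at hη

end Lift

/-! ### Geodesics -/

namespace InnerProd

section LieAlgebra
variable {𝔤 : Type*} [LieRing 𝔤] [LieAlgebra ℝ 𝔤] [FiniteDimensional ℝ 𝔤] (g : InnerProd 𝔤)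

/-- The bilinear map `(u, v) ↦ ad⋆_u v`. -/
noncomputable def adStarBilin : 𝔤 →ₗ[ℝ] 𝔤 →ₗ[ℝ] 𝔤 :=
  LinearMap.mk₂ ℝ (fun u v => g.adStar u v)
    (fun u u' v => g.eq_of_form_eq fun x => by
      simp only [map_add, LinearMap.add_apply, form_adStar, add_lie])
    (fun c u v => g.eq_of_form_eq fun x => by
      simp only [map_smul, LinearMap.smul_apply, form_adStar, smul_lie])
    (fun u v v' => map_add _ _ _) (fun c u v => map_smul _ _ _)

theorem form_adStarBilin_diag (u : 𝔤) : g.form (g.adStarBilin u u) u = 0 := by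
  change g.form (g.adStar u u) u = 0
  rw [form_adStar, lie_self, map_zero]

end LieAlgebra

end InnerProd

section Geodesic
variable {E : Type*} [NormedAddCommGroup E] [NormedSpace ℝ E] [FiniteDimensional ℝ E]
  {G : Type*} [TopologicalSpace G] [ChartedSpace E G] [Group G] [LieGroup 𝓘(ℝ, E) ∞ G]
  (g : InnerProd (GroupLieAlgebra 𝓘(ℝ, E) G))

/-- `ad⋆` as a bilinear map on the model space. -/
noncomputable def eulerArnoldBilin : E →ₗ[ℝ] E →ₗ[ℝ] E := g.adStarBilin

variable {g}

theorem isGeodesic_iff {γ : ℝ → G} {u : ℝ → E} : IsGeodesic g γ u ↔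
    (∀ t, IsLiftAt γ u t) ∧ ∀ t, HasDerivAt u (eulerArnoldBilin g (u t) (u t)) t :=
  ⟨fun h => ⟨h.flow, h.eulerArnold⟩, fun h => ⟨h.1, h.2⟩⟩

variable (g) in
/-- Geodesic completeness: `g(ad⋆_u u, u) = 0`, so the Euler–Arnold equation conserves `g(u, u)` and
its solutions are global. -/
theorem exists_isGeodesic [T2Space G] (v : E) :
    ∃ (γ : ℝ → G) (u : ℝ → E), IsGeodesic g γ u ∧ γ 0 = 1 ∧ u 0 = v := by
  let g' : InnerProd E := g
  obtain ⟨u, hu0, hu⟩ := g'.exists_forall_hasDerivAt_bilin_diag (eulerArnoldBilin g)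
    g.form_adStarBilin_diag v
  have huc : ContDiff ℝ 1 u := by
    rw [contDiff_one_iff_deriv]
    have hd : Differentiable ℝ u := fun t => (hu t).differentiableAt
    refine ⟨hd, ?_⟩
    rw [show deriv u = fun t => eulerArnoldBilin g (u t) (u t) from funext fun t => (hu t).deriv]
    exact (contDiff_bilin_diag (n := 0) (eulerArnoldBilin g)).continuous.comp hd.continuous
  obtain ⟨γ, hγ0, hγ⟩ := exists_forall_isLiftAt (G := G) huc
  exact ⟨γ, u, isGeodesic_iff.mpr ⟨hγ, hu⟩, hγ0, hu0⟩

theorem IsGeodesic.eq_of_eq_zero {γ₁ γ₂ : ℝ → G} {u₁ u₂ : ℝ → E} (h₁ : IsGeodesic g γ₁ u₁)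
    (h₂ : IsGeodesic g γ₂ u₂) (hu : u₁ 0 = u₂ 0) : u₁ = u₂ :=
  eq_of_forall_hasDerivAt (contDiff_bilin_diag (eulerArnoldBilin g)) (isGeodesic_iff.mp h₁).2
    (isGeodesic_iff.mp h₂).2 hu

theorem IsGeodesic.curve_eq [T2Space G] {γ₁ γ₂ : ℝ → G} {u₁ u₂ : ℝ → E}
    (h₁ : IsGeodesic g γ₁ u₁) (h₂ : IsGeodesic g γ₂ u₂) (hγ : γ₁ 0 = γ₂ 0) (hu : u₁ 0 = u₂ 0) :
    γ₁ = γ₂ := by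
  have h := h₁.eq_of_eq_zero h₂ hu
  subst h
  ext t
  have ht : t ∈ Ioo (-(|t| + 1)) (|t| + 1) := by
    constructor <;> linarith [neg_abs_le t, le_abs_self t]
  have h0 : (0 : ℝ) ∈ Ioo (-(|t| + 1)) (|t| + 1) := by
    constructor <;> linarith [abs_nonneg t]
  exact IsLiftAt.eqOn (u := u₁) (fun s _ => (isGeodesic_iff.mp h₁).1 s)
    (fun s _ => (isGeodesic_iff.mp h₂).1 s) h0 hγ ht

/-- Rescaling time by `c` multiplies the initial velocity of a geodesic by `c`. -/
theorem IsGeodesic.comp_mul {γ : ℝ → G} {u : ℝ → E} (h : IsGeodesic g γ u) (c : ℝ) :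
    IsGeodesic g (fun t => γ (c * t)) (fun t => c • u (c * t) : ℝ → E) := by
  rw [isGeodesic_iff] at h ⊢
  refine ⟨fun t => ?_, fun t => ?_⟩
  · have h1 := HasVelocityAt.comp_mul c (h.1 (c * t))
    rw [← map_smul] at h1
    exact h1
  · have h1 : HasDerivAt (fun s => c * s) c t := by
      simpa using (hasDerivAt_id' t).const_mul c
    have h2 := ((h.2 (c * t)).scomp t h1).const_smul c
    simp only [map_smul, LinearMap.smul_apply]
    exact h2

/-- The Riemannian exponential map follows geodesics: `exp(c u(0)) = γ(c)`. -/
theorem IsGeodesic.riemannianExp_smul [T2Space G] {γ : ℝ → G} {u : ℝ → E}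
    (h : IsGeodesic g γ u) (hγ : γ 0 = 1) (c : ℝ) : riemannianExp g (c • u 0) = γ c := by
  have hex : ∃ p : (ℝ → G) × (ℝ → GroupLieAlgebra 𝓘(ℝ, E) G),
      IsGeodesic g p.1 p.2 ∧ p.1 0 = 1 ∧ p.2 0 = c • u 0 :=
    ⟨(fun t => γ (c * t), fun t => c • u (c * t)), h.comp_mul c, by simpa using hγ,
      by simp only [mul_zero]; rfl⟩
  rw [riemannianExp, dif_pos hex]
  obtain ⟨h1, h2, h3⟩ := hex.choose_spec
  have h4 := h1.curve_eq (h.comp_mul c) (by simpa [hγ] using h2)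
    (h3.trans (congrArg (fun s => c • u s) (mul_zero c).symm))
  rw [h4]
  exact congrArg γ (mul_one c)

variable (g) in
/-- The system solved by `(γ₀⁻¹ γ, u)`, where `γ` is a geodesic with left-translated velocity `u`
and `γ₀' = γ₀ u₀`, in the chart at the identity. -/
noncomputable def relativeField (u₀ : E) (q : E × E) : E × E :=
  (chartLeft E G q.1 q.2 - chartRight E G q.1 u₀, eulerArnoldBilin g q.2 q.2)

/-- The linearized geodesic equation. The chart terms combine into the Lie bracket because the
second derivative of the multiplication is symmetric. -/
theorem hasFDerivAt_relativeField (u₀ : E) (L F : E →L[ℝ] E)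
    (hL : ∀ y : GroupLieAlgebra 𝓘(ℝ, E) G,
      L y = InnerProd.opL (𝔤 := GroupLieAlgebra 𝓘(ℝ, E) G) u₀ y)
    (hF : ∀ z : GroupLieAlgebra 𝓘(ℝ, E) G, F z = g.opF u₀ z) :
    HasFDerivAt (relativeField g u₀)
      ((ContinuousLinearMap.snd ℝ E E - L.comp (ContinuousLinearMap.fst ℝ E E)).prod
        (F.comp (ContinuousLinearMap.snd ℝ E E))) (chartOne E G, u₀) := by
  have h1 := ((hasFDerivAt_fderiv_chartMul (E := E) (G := G)).comp
    (f := fun q : E × E => (q.1, chartOne E G)) (chartOne E G, u₀)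
    (hasFDerivAt_fst.prodMk (hasFDerivAt_const _ _))).clm_apply
    ((hasFDerivAt_const (0 : E) _).prodMk hasFDerivAt_snd)
  have h2 := (hasFDerivAt_chartRight (E := E) (G := G) u₀).comp (chartOne E G, u₀)
    (f := Prod.fst) hasFDerivAt_fst
  let b' : E →L[ℝ] E →L[ℝ] E := LinearMap.toContinuousLinearMap
    (LinearMap.toContinuousLinearMap.toLinearMap ∘ₗ eulerArnoldBilin g)
  have h3 := (b'.isBoundedBilinearMap.hasFDerivAt (u₀, u₀)).comp (chartOne E G, u₀)
    (f := fun q : E × E => (q.2, q.2)) (hasFDerivAt_snd.prodMk hasFDerivAt_snd)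
  refine HasFDerivAt.congr_fderiv (HasFDerivAt.prodMk (h1.sub h2) h3) ?_
  refine ContinuousLinearMap.ext fun q => Prod.ext ?_ ?_
  · have h4 : L q.1 = (chartMulSnd E G (u₀, 0) (0, q.1) - chartMulSnd E G (q.1, 0) (0, u₀) : E) :=
      (hL q.1).trans (lie_eq_chartMulSnd (G := G) u₀ q.1)
    have h5 := chartLeft_chartOne (E := E) (G := G) q.2
    rw [chartLeft] at h5
    have h6 := chartMulSnd_symm (E := E) (G := G) (0, q.1) (u₀, 0)
    simp [h4, h5, h6]
    abel
  · exact (hF q.2).symm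

end Geodesic

/-! ### The derivative of the Riemannian exponential map -/

section ExpDeriv
variable {E : Type*} [NormedAddCommGroup E] [NormedSpace ℝ E] [FiniteDimensional ℝ E]
  {G : Type*} [TopologicalSpace G] [ChartedSpace E G] [Group G] [LieGroup 𝓘(ℝ, E) ∞ G] [T2Space G]
  {g : InnerProd (GroupLieAlgebra 𝓘(ℝ, E) G)}

/-- The derivative of the Riemannian exponential map at `τ u₀`, for a steady `u₀`: up to a left
translation and the factor `τ⁻¹` it is the solution operator `z(0) ↦ y(τ)` of the linearized
geodesic equation `y' = z - L y`, `z' = F z` with `y(0) = 0`. -/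
theorem exists_hasModelDerivAt_riemannianExp {u₀ : E}
    (hu₀ : InnerProd.IsSteady (𝔤 := GroupLieAlgebra 𝓘(ℝ, E) G) g u₀) (L F : E →L[ℝ] E)
    (hL : ∀ y : GroupLieAlgebra 𝓘(ℝ, E) G,
      L y = InnerProd.opL (𝔤 := GroupLieAlgebra 𝓘(ℝ, E) G) u₀ y)
    (hF : ∀ z : GroupLieAlgebra 𝓘(ℝ, E) G, F z = g.opF u₀ z)
    {y z : E → ℝ → E} (hy0 : ∀ w, y w 0 = 0) (hz0 : ∀ w, z w 0 = w)
    (hy : ∀ w t, HasDerivAt (y w) (z w t - L (y w t)) t)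
    (hz : ∀ w t, HasDerivAt (z w) (F (z w t)) t)
    {τ : ℝ} (hτ : 0 < τ) (Y Z : E →L[ℝ] E) (hY : ∀ w, y w τ = Y w) (hZ : ∀ w, z w τ = Z w) :
    ∃ a : G, HasModelDerivAt (riemannianExp g)
      ((leftD a 1).comp (Y.comp (τ⁻¹ • ContinuousLinearMap.id ℝ E))) (τ • u₀) := by
  choose γ u hγ hγ0 hu0 using fun w : E => exists_isGeodesic g (u₀ + w)
  have hlift : ∀ w t, IsLiftAt (γ w) (u w) t := fun w => (isGeodesic_iff.mp (hγ w)).1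
  have hEA : ∀ w t, HasDerivAt (u w) (eulerArnoldBilin g (u w t) (u w t)) t :=
    fun w => (isGeodesic_iff.mp (hγ w)).2
  have hst : eulerArnoldBilin g u₀ u₀ = 0 := hu₀
  have hconst : u 0 = fun _ => u₀ :=
    eq_of_forall_hasDerivAt (contDiff_bilin_diag (eulerArnoldBilin g)) (hEA 0)
      (fun t => by rw [hst]; exact hasDerivAt_const t u₀) (by simp [hu0])
  -- the motion relative to the steady geodesic
  set h : E → ℝ → G := fun w t => (γ 0 t)⁻¹ * γ w t with hh
  have hhv : ∀ w t, HasVelocityAt (h w)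
      (leftD (h w t) 1 (u w t) - rightD (h w t) 1 u₀) t := fun w t => by
    have := (hlift 0 t).inv_mul (hlift w t)
    rwa [hconst] at this
  let e : OpenPartialHomeomorph (G × E) (E × E) :=
    (chartAt E (1 : G)).prod (OpenPartialHomeomorph.refl E)
  have hes : ∀ q : G × E, q ∈ e.source ↔ q.1 ∈ (extChartAt 𝓘(ℝ, E) (1 : G)).source := fun q => by
    simp [e]
  have hemem : ∀ q : G × E, e q = (extChartAt 𝓘(ℝ, E) (1 : G) q.1, q.2) := fun q => by
    simp [e]
  have hV0 : relativeField g u₀ (chartOne E G, u₀) = 0 := by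
    simp [relativeField, chartLeft_chartOne, chartRight_chartOne, hst]
  obtain ⟨hsrc, hbase, hder⟩ := hasFDerivAt_of_equilibrium e (p := (chartOne E G, u₀))
    (by
      have h1 := chartOne_mem_target (E := E) (G := G)
      simpa [e] using h1)
    (hasFDerivAt_relativeField u₀ L F hL hF) hV0
    (ContinuousLinearMap.inr ℝ E E) (c := fun w t => (h w t, u w t))
    (fun w => continuous_iff_continuousAt.mpr fun t =>
      (hhv w t).continuousAt.prodMk (hEA w t).continuousAt)
    (Eventually.of_forall fun w => by
      have h1 : h w 0 = 1 := by simp [hh, hγ0]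
      refine ⟨(hes _).mpr ?_, ?_⟩
      · simp only [h1]
        exact mem_extChartAt_source _
      · rw [hemem]
        simp [h1, hu0, chartOne])
    (fun w t hs => by
      obtain ⟨A, hA, hAl, hAr⟩ := hasModelDerivAt_extChartAt ((hes _).mp hs)
      have h1 := hasVelocityAt_iff_hasDerivAt.mp (hA.comp_hasVelocityAt (hhv w t))
      simp only [hemem]
      refine HasDerivAt.prodMk (h1.congr_deriv ?_) (hEA w t)
      rw [map_sub]
      exact congrArg₂ (· - ·) (hAl _) (hAr _))
    (y := fun w t => (y w t, z w t)) (fun w => by simp [hy0, hz0])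
    (fun w t => by
      refine HasDerivAt.prodMk ((hy w t).congr_deriv ?_) ((hz w t).congr_deriv ?_) <;> simp)
    (T := τ) hτ.le
    (Y.prod Z) (fun w => by simp [hY, hZ])
  refine ⟨γ 0 τ, ?_⟩
  have hx : HasModelDerivAt (fun w => extChartAt 𝓘(ℝ, E) (1 : G) (h w τ)) Y 0 := by
    have h1 := (ContinuousLinearMap.fst ℝ E E).hasFDerivAt.comp (0 : E) hder
    simp only [hemem] at h1
    exact HasModelDerivAt.of_hasFDerivAt h1
  have hx0 : extChartAt 𝓘(ℝ, E) (1 : G) (h 0 τ) = chartOne E G := by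
    rw [hemem] at hbase
    exact congrArg Prod.fst hbase
  have haff : HasFDerivAt (fun v : E => τ⁻¹ • v - u₀) (τ⁻¹ • ContinuousLinearMap.id ℝ E)
      (τ • u₀) :=
    ((hasFDerivAt_id (τ • u₀)).const_smul τ⁻¹).sub_const u₀
  have hw0 : τ⁻¹ • τ • u₀ - u₀ = 0 := by rw [inv_smul_smul₀ hτ.ne', sub_self]
  have h1 := hx.comp (HasModelDerivAt.of_hasFDerivAt haff) hw0
  have hsymm : HasModelDerivAt (extChartAt 𝓘(ℝ, E) (1 : G)).symm (ContinuousLinearMap.id ℝ E)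
      (chartOne E G) := hasMFDerivAt_extChartAt_symm_chartOne E G
  have h2 := hsymm.comp h1 (by rw [hw0, hx0])
  have h3 := (hasModelDerivAt_leftD (E := E) (γ 0 τ) 1).comp h2 (by
    rw [hw0, hx0, extChartAt_symm_chartOne])
  refine HasModelDerivAt.congr_of_eventuallyEq h3 ?_
  have hev : ∀ᶠ v in 𝓝 (τ • u₀), (h (τ⁻¹ • v - u₀) τ, u (τ⁻¹ • v - u₀) τ) ∈ e.source :=
    haff.continuousAt.eventually (p := fun w => (h w τ, u w τ) ∈ e.source)
      (by simpa only [hw0] using hsrc)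
  filter_upwards [hev] with v hv
  rw [(extChartAt 𝓘(ℝ, E) (1 : G)).left_inv ((hes _).mp hv)]
  simp only [hh, mul_inv_cancel_left]
  rw [← (hγ (τ⁻¹ • v - u₀)).riemannianExp_smul (hγ0 _) τ, hu0, add_sub_cancel,
    smul_inv_smul₀ hτ.ne']

end ExpDeriv

/-! ### Exponentials of endomorphisms -/

section EndExp
variable {V : Type*} [AddCommGroup V] [Module ℝ V] [FiniteDimensional ℝ V]

theorem endExp_zero : endExp (0 : V →ₗ[ℝ] V) = LinearMap.id := by
  simp [endExp]

theorem endExp_add_smul (A : V →ₗ[ℝ] V) (s t : ℝ) :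
    endExp ((s + t) • A) = endExp (s • A) ∘ₗ endExp (t • A) := by
  have hcomm : Commute (s • LinearMap.toMatrix (Module.finBasis ℝ V) (Module.finBasis ℝ V) A)
      (t • LinearMap.toMatrix (Module.finBasis ℝ V) (Module.finBasis ℝ V) A) :=
    ((Commute.refl _).smul_left s).smul_right t
  rw [endExp, endExp, endExp, ← Matrix.toLin_mul, map_smul, map_smul, map_smul, add_smul,
    Matrix.exp_add_of_commute _ _ hcomm]

theorem endExp_neg_comp (A : V →ₗ[ℝ] V) (t : ℝ) :
    endExp ((-t) • A) ∘ₗ endExp (t • A) = LinearMap.id := by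
  rw [← endExp_add_smul, neg_add_cancel, zero_smul, endExp_zero]

attribute [local instance] Matrix.linftyOpNormedRing Matrix.linftyOpNormedAlgebra in
theorem hasDerivAt_endExp_smul {E : Type*} [NormedAddCommGroup E] [NormedSpace ℝ E]
    (φ : V →ₗ[ℝ] E) (A : V →ₗ[ℝ] V) (v : V) (t : ℝ) :
    HasDerivAt (fun s : ℝ => φ (endExp (s • A) v)) (φ (A (endExp (t • A) v))) t := by
  set β := Module.finBasis ℝ V
  set M := LinearMap.toMatrix β β A with hM
  let ψ : Matrix (Fin (Module.finrank ℝ V)) (Fin (Module.finrank ℝ V)) ℝ →ₗ[ℝ] E :=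
    φ ∘ₗ LinearMap.applyₗ v ∘ₗ (Matrix.toLin β β).toLinearMap
  have h1 : HasDerivAt (fun s : ℝ => NormedSpace.exp (s • M)) (M * NormedSpace.exp (t • M)) t :=
    hasDerivAt_exp_smul_const' (𝕂 := ℝ) M t
  have h2 := (LinearMap.toContinuousLinearMap ψ).hasFDerivAt.comp_hasDerivAt t h1
  have h3 : (fun s : ℝ => φ (endExp (s • A) v)) = ψ ∘ fun s => NormedSpace.exp (s • M) := by
    ext s
    simp [ψ, endExp, hM, β]
  rw [h3]
  refine h2.congr_deriv ?_
  change φ (Matrix.toLin β β (M * NormedSpace.exp (t • M)) v) = _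
  rw [Matrix.toLin_mul β β β]
  simp [endExp, hM, β]

end EndExp

/-! ### The linearized equation on the orthogonal complement -/

section PerpOperator
variable {V : Type*} [AddCommGroup V] [Module ℝ V] [FiniteDimensional ℝ V]

/-- The operator `R e^{tF} - e^{-tL} R`. When `R F + L R = 1` it equals `∫₀ᵗ e^{(s-t)L} e^{sF} ds`,
the solution operator `z(0) ↦ y(t)` of `y' = z - L y`, `z' = F z` with `y(0) = 0`. -/
noncomputable def solutionOp (L F R : V →ₗ[ℝ] V) (t : ℝ) : V →ₗ[ℝ] V :=
  R ∘ₗ endExp (t • F) - endExp ((-t) • L) ∘ₗ R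

theorem solutionOp_zero (L F R : V →ₗ[ℝ] V) : solutionOp L F R 0 = 0 := by
  simp [solutionOp, endExp_zero]

theorem det_endExp_smul_ne_zero (A : V →ₗ[ℝ] V) (t : ℝ) : LinearMap.det (endExp (t • A)) ≠ 0 := by
  intro h
  have h1 := congrArg LinearMap.det (endExp_neg_comp A t)
  rw [LinearMap.det_comp, h, mul_zero, LinearMap.det_id] at h1
  exact zero_ne_one h1

/-- The operator of the determinant criterion at `t` is the solution operator at `2 t` between
invertible factors. -/
theorem endExp_sandwich_eq (L F R : V →ₗ[ℝ] V) (t : ℝ) :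
    endExp (t • L) ∘ₗ R ∘ₗ endExp (t • F) - endExp ((-t) • L) ∘ₗ R ∘ₗ endExp ((-t) • F) =
      endExp (t • L) ∘ₗ solutionOp L F R (2 * t) ∘ₗ endExp ((-t) • F) := by
  have h1 : endExp ((2 * t) • F) ∘ₗ endExp ((-t) • F) = endExp (t • F) := by
    rw [← endExp_add_smul]
    congr 2
    ring
  have h2 : endExp (t • L) ∘ₗ endExp ((-(2 * t)) • L) = endExp ((-t) • L) := by
    rw [← endExp_add_smul]
    congr 2
    ring
  rw [solutionOp, LinearMap.sub_comp, LinearMap.comp_sub, LinearMap.comp_assoc, h1,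
    LinearMap.comp_assoc, ← LinearMap.comp_assoc _ _ (endExp (t • L)), ← h2]
  simp only [LinearMap.comp_assoc]

theorem det_endExp_sandwich_eq_zero_iff (L F R : V →ₗ[ℝ] V) (t : ℝ) :
    LinearMap.det (endExp (t • L) ∘ₗ R ∘ₗ endExp (t • F) -
      endExp ((-t) • L) ∘ₗ R ∘ₗ endExp ((-t) • F)) = 0 ↔
      ¬ Function.Injective (solutionOp L F R (2 * t)) := by
  rw [endExp_sandwich_eq, LinearMap.det_comp, LinearMap.det_comp]
  rw [mul_eq_zero_iff_left (det_endExp_smul_ne_zero _ _),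
    mul_eq_zero_iff_right (det_endExp_smul_ne_zero _ _), LinearMap.det_eq_zero_iff_ker_ne_bot,
    Ne, LinearMap.ker_eq_bot]

end PerpOperator

section Linearized

variable {E : Type*} [NormedAddCommGroup E] [NormedSpace ℝ E] [FiniteDimensional ℝ E]

/-- Explicit solutions of the linearized geodesic equation on `ℝ u₀ ⊕ P`, where `L` and `F` vanish
on `u₀` and preserve `P`: on the first summand the solution operator is multiplication by `τ`, on
the second it is `solutionOp`. -/
theorem exists_linearized_solution {P : Submodule ℝ E} {u₀ : E} (a : E →ₗ[ℝ] ℝ) (π : E →ₗ[ℝ] P)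
    (hdec : ∀ w, a w • u₀ + (π w : E) = w) (hind : ∀ (c : ℝ) (p : P), c • u₀ + (p : E) = 0 → p = 0)
    {L F : E →L[ℝ] E} {L' F' R : P →ₗ[ℝ] P} (hL : ∀ p : P, (L' p : E) = L p)
    (hF : ∀ p : P, (F' p : E) = F p) (hLu : L u₀ = 0) (hFu : F u₀ = 0)
    (hR : R ∘ₗ F' + L' ∘ₗ R = LinearMap.id) :
    ∃ y z : E → ℝ → E, (∀ w, y w 0 = 0) ∧ (∀ w, z w 0 = w) ∧
      (∀ w t, HasDerivAt (y w) (z w t - L (y w t)) t) ∧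
      (∀ w t, HasDerivAt (z w) (F (z w t)) t) ∧
      ∀ τ : ℝ, τ ≠ 0 → ∃ Y Z : E →L[ℝ] E, (∀ w, y w τ = Y w) ∧ (∀ w, z w τ = Z w) ∧
        (Function.Injective Y ↔ Function.Injective (solutionOp L' F' R τ)) := by
  refine ⟨fun w t => (a w * t) • u₀ + (solutionOp L' F' R t (π w) : E),
    fun w t => a w • u₀ + (endExp (t • F') (π w) : E), fun w => ?_, fun w => ?_, fun w t => ?_,
    fun w t => ?_, fun τ hτ => ?_⟩
  · simp [solutionOp_zero]
  · simp [endExp_zero, hdec]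
  · have h1 := hasDerivAt_endExp_smul (P.subtype ∘ₗ R) F' (π w) t
    have h2 : HasDerivAt (fun s : ℝ => ((endExp ((-s) • L') (R (π w)) : P) : E))
        (-((L' (endExp ((-t) • L') (R (π w))) : P) : E)) t := by
      have := (hasDerivAt_endExp_smul P.subtype L' (R (π w)) (-t)).scomp t (hasDerivAt_neg t)
      simpa [Function.comp_def] using this
    have h3 : HasDerivAt (fun s : ℝ => (a w * s) • u₀) (a w • u₀) t := by
      simpa using ((hasDerivAt_id' t).const_mul (a w)).smul_const u₀
    refine (h3.fun_add (h1.fun_sub h2)).congr_deriv ?_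
    have h4 := congrArg (fun A : P →ₗ[ℝ] P => ((A (endExp (t • F') (π w)) : P) : E)) hR
    simp only [LinearMap.add_apply, LinearMap.comp_apply, LinearMap.id_apply, Submodule.coe_add]
      at h4
    beta_reduce
    rw [map_add, map_smul, hLu, smul_zero, zero_add, ← hL, ← h4]
    simp only [solutionOp, LinearMap.sub_apply, LinearMap.comp_apply, map_sub, Submodule.coe_sub,
      Submodule.subtype_apply]
    abel
  · have h1 := hasDerivAt_endExp_smul P.subtype F' (π w) t
    refine (h1.const_add (a w • u₀)).congr_deriv ?_
    rw [map_add, map_smul, hFu, smul_zero, zero_add, ← hF]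
    rfl
  · refine ⟨LinearMap.toContinuousLinearMap
      (τ • a.smulRight u₀ + P.subtype ∘ₗ solutionOp L' F' R τ ∘ₗ π), LinearMap.toContinuousLinearMap
      (a.smulRight u₀ + P.subtype ∘ₗ endExp (τ • F') ∘ₗ π), fun w => ?_, fun w => rfl, ?_⟩
    · simp [smul_smul, mul_comm]
    · have hY : ∀ w, (LinearMap.toContinuousLinearMap
          (τ • a.smulRight u₀ + P.subtype ∘ₗ solutionOp L' F' R τ ∘ₗ π)) w =
          (τ * a w) • u₀ + (solutionOp L' F' R τ (π w) : E) := fun w => by simp [smul_smul]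
      have hsplit : ∀ (c : ℝ) (p : P), c • u₀ + (p : E) = 0 → c • u₀ = 0 ∧ p = 0 := fun c p h =>
        ⟨by simpa [hind c p h] using h, hind c p h⟩
      rw [injective_iff_map_eq_zero, injective_iff_map_eq_zero]
      constructor
      · intro h p hp
        have h1 := hsplit (a p) (π p - p) (by
          rw [Submodule.coe_sub, ← add_sub_assoc, hdec, sub_self])
        have h2 : π p = p := sub_eq_zero.mp h1.2
        have h3 := h p (by rw [hY, h2, hp, mul_smul, h1.1]; simp)
        exact Subtype.ext h3
      · intro h w hw
        rw [hY] at hw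
        obtain ⟨h1, h2⟩ := hsplit _ _ hw
        have h3 := h _ h2
        have h4 : a w • u₀ = 0 := by
          rw [mul_smul] at h1
          exact (smul_eq_zero.mp h1).resolve_left hτ
        rw [← hdec w, h3, h4]
        simp

end Linearized

/-! ### Conjugate points along a steady geodesic -/

namespace InnerProd

section Projection

variable {V : Type*} [AddCommGroup V] [Module ℝ V] (g : InnerProd V) (u₀ : V)

theorem mem_perp {u v : V} : v ∈ g.perp u ↔ g.form v u = 0 := Iff.rfl

/-- The `u₀`-coordinate of a vector; its value is `0` when `u₀ = 0`. -/
noncomputable def coord : V →ₗ[ℝ] ℝ := (g.form u₀ u₀)⁻¹ • g.form u₀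

theorem sub_coord_mem_perp (w : V) : w - g.coord u₀ w • u₀ ∈ g.perp u₀ := by
  rw [mem_perp, map_sub, LinearMap.sub_apply, map_smul, LinearMap.smul_apply, g.symm w u₀]
  rcases eq_or_ne u₀ 0 with rfl | h
  · simp
  · simp [coord, (g.pos u₀ h).ne', mul_comm]

/-- The orthogonal projection to `u₀^⊥`. -/
noncomputable def projPerp : V →ₗ[ℝ] g.perp u₀ :=
  (LinearMap.id - (g.coord u₀).smulRight u₀).codRestrict (g.perp u₀) (g.sub_coord_mem_perp u₀)

theorem coord_smul_add_projPerp (w : V) : g.coord u₀ w • u₀ + (g.projPerp u₀ w : V) = w := by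
  change g.coord u₀ w • u₀ + (w - g.coord u₀ w • u₀) = w
  rw [add_sub_cancel]

/-- The sum of `ℝ u₀` and `u₀^⊥` is direct, also when `u₀ = 0`. -/
theorem eq_zero_of_smul_add_eq_zero (c : ℝ) (p : g.perp u₀) (h : c • u₀ + (p : V) = 0) :
    p = 0 := by
  by_contra hp
  have h1 := g.pos p fun h0 => hp (Subtype.ext h0)
  have h2 : (p : V) = -(c • u₀) := (neg_eq_of_add_eq_zero_right h).symm
  have h3 : g.form p p = 0 := by
    refine (congrArg (g.form p) h2).trans ?_
    rw [map_neg, map_smul, g.mem_perp.mp p.2, smul_zero, neg_zero]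
  exact h1.ne' h3

end Projection

section Steady

variable {𝔤 : Type*} [LieRing 𝔤] [LieAlgebra ℝ 𝔤] [FiniteDimensional ℝ 𝔤] {g : InnerProd 𝔤}
  {u₀ : 𝔤}

theorem opF_apply (g : InnerProd 𝔤) (u₀ v : 𝔤) : g.opF u₀ v = g.adStar u₀ v + g.adStar v u₀ := rfl

theorem IsSteady.form_lie (h : g.IsSteady u₀) (v : 𝔤) : g.form u₀ ⁅u₀, v⁆ = 0 := by
  rw [← form_adStar, show g.adStar u₀ u₀ = 0 from h, map_zero, LinearMap.zero_apply]

theorem IsSteady.opL_mem_perp (h : g.IsSteady u₀) (v : 𝔤) : opL u₀ v ∈ g.perp u₀ := by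
  rw [mem_perp, show opL u₀ v = ⁅u₀, v⁆ from rfl, g.symm, h.form_lie]

theorem IsSteady.opF_mem_perp (h : g.IsSteady u₀) (v : 𝔤) : g.opF u₀ v ∈ g.perp u₀ := by
  rw [mem_perp, opF_apply, map_add, LinearMap.add_apply, form_adStar, form_adStar, lie_self,
    map_zero, ← lie_skew, map_neg, h.form_lie, neg_zero, add_zero]

theorem IsSteady.opF_self (h : g.IsSteady u₀) : g.opF u₀ u₀ = 0 := by
  rw [opF_apply, show g.adStar u₀ u₀ = 0 from h, add_zero]

end Steady

end InnerProd

section Conjugate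
variable {E : Type*} [NormedAddCommGroup E] [NormedSpace ℝ E] [FiniteDimensional ℝ E]
  {G : Type*} [TopologicalSpace G] [ChartedSpace E G] [Group G] [LieGroup 𝓘(ℝ, E) ∞ G]

/-- Conjugacy at `τ` tested on a derivative `A` of the exponential map at `τ u₀`. Its existence
makes the differentiability clause of `IsConjugateTime` hold. -/
theorem HasModelDerivAt.isConjugateTime_iff {g : InnerProd (GroupLieAlgebra 𝓘(ℝ, E) G)} {u₀ : E}
    {τ : ℝ} {A : E →L[ℝ] E} (h : HasModelDerivAt (riemannianExp g) A (τ • u₀)) :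
    IsConjugateTime g u₀ τ ↔ ¬ Function.Bijective A := by
  have h1 : mfderiv 𝓘(ℝ, E) 𝓘(ℝ, E) (riemannianExp g) (τ • u₀ : E) = A := HasMFDerivAt.mfderiv h
  have h2 : Function.Bijective (mfderiv 𝓘(ℝ, E) 𝓘(ℝ, E) (riemannianExp g) (τ • u₀ : E)) ↔
      Function.Bijective A := iff_of_eq (congrArg (fun B : E →L[ℝ] E => Function.Bijective B) h1)
  exact ⟨fun hc hA => hc.2 (h2.mpr hA), fun hA => ⟨h.mdifferentiableAt, fun hc => hA (h2.mp hc)⟩⟩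

/-- Up to bijections, the derivative of the exponential map at `τ u₀` is `τ` on the line of `u₀` and
`solutionOp L F R τ` on `u₀^⊥`, so only the second summand can be singular. -/
theorem isConjugateTime_iff_not_injective_solutionOp [T2Space G]
    {g : InnerProd (GroupLieAlgebra 𝓘(ℝ, E) G)} {u₀ : GroupLieAlgebra 𝓘(ℝ, E) G}
    (hu₀ : g.IsSteady u₀) {L F R : g.perp u₀ →ₗ[ℝ] g.perp u₀}
    (hL : L = (InnerProd.opL u₀).restrict fun v _ => hu₀.opL_mem_perp v)
    (hF : F = (g.opF u₀).restrict fun v _ => hu₀.opF_mem_perp v)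
    (hR : R ∘ₗ F + L ∘ₗ R = LinearMap.id) {τ : ℝ} (hτ : 0 < τ) :
    IsConjugateTime g u₀ τ ↔ ¬ Function.Injective (solutionOp L F R τ) := by
  let Lc : E →L[ℝ] E := LinearMap.toContinuousLinearMap
    (InnerProd.opL (𝔤 := GroupLieAlgebra 𝓘(ℝ, E) G) u₀ : E →ₗ[ℝ] E)
  let Fc : E →L[ℝ] E := LinearMap.toContinuousLinearMap (g.opF u₀ : E →ₗ[ℝ] E)
  obtain ⟨y, z, hy0, hz0, hy, hz, hYZ⟩ := exists_linearized_solution (E := E)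
    (P := g.perp u₀) (u₀ := u₀) (g.coord u₀) (g.projPerp u₀) (g.coord_smul_add_projPerp u₀)
    (g.eq_zero_of_smul_add_eq_zero u₀) (L := Lc) (F := Fc) (L' := L) (F' := F) (R := R)
    (fun p => by rw [hL]; rfl) (fun p => by rw [hF]; rfl) (lie_self u₀) hu₀.opF_self hR
  obtain ⟨Y, Z, hY, hZ, hinj⟩ := hYZ τ hτ.ne'
  obtain ⟨a, ha⟩ := exists_hasModelDerivAt_riemannianExp hu₀ Lc Fc (fun _ => rfl) (fun _ => rfl)
    hy0 hz0 hy hz hτ Y Z hY hZ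
  rw [ha.isConjugateTime_iff, not_iff_not]
  refine Iff.trans ?_ hinj
  have hscale : Function.Bijective (τ⁻¹ • ContinuousLinearMap.id ℝ E : E →L[ℝ] E) :=
    (MulAction.bijective (Units.mk0 τ⁻¹ (inv_ne_zero hτ.ne')))
  rw [ContinuousLinearMap.coe_comp, ContinuousLinearMap.coe_comp,
    Function.Bijective.of_comp_iff' (leftD_bijective a 1), hscale.of_comp_iff]
  exact ⟨fun h => h.1, fun h => ⟨h, LinearMap.injective_iff_surjective (f := Y.toLinearMap).mp h⟩⟩

end Conjugate

theorem mainTheorem3 {E : Type*} [NormedAddCommGroup E] [NormedSpace ℝ E] [FiniteDimensional ℝ E]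
    {G : Type*} [TopologicalSpace G] [T2Space G] [ChartedSpace E G] [Group G]
    [LieGroup 𝓘(ℝ, E) ∞ G]
    (g : InnerProd (GroupLieAlgebra 𝓘(ℝ, E) G))
    (u₀ : GroupLieAlgebra 𝓘(ℝ, E) G) (hu₀ : g.IsSteady u₀) :
    ∃ (hL : ∀ v ∈ g.perp u₀, InnerProd.opL u₀ v ∈ g.perp u₀)
      (hF : ∀ v ∈ g.perp u₀, g.opF u₀ v ∈ g.perp u₀),
      ∀ L F R : g.perp u₀ →ₗ[ℝ] g.perp u₀,
        L = (InnerProd.opL u₀).restrict hL → F = (g.opF u₀).restrict hF →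
        R ∘ₗ F + L ∘ₗ R = LinearMap.id →
        ((∃ τ : ℝ, 0 < τ ∧ IsConjugateTime g u₀ τ) ↔
          ∃ τ : ℝ, 0 < τ ∧
            LinearMap.det (endExp (τ • L) ∘ₗ R ∘ₗ endExp (τ • F) -
              endExp ((-τ) • L) ∘ₗ R ∘ₗ endExp ((-τ) • F)) = 0) := by
  refine ⟨fun v _ => hu₀.opL_mem_perp v, fun v _ => hu₀.opF_mem_perp v,
    fun L F R hL hF hR => ⟨?_, ?_⟩⟩
  -- A conjugate time `τ` corresponds to a zero of the determinant at `τ / 2`.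
  · rintro ⟨τ, hτ, h⟩
    refine ⟨τ / 2, half_pos hτ, (det_endExp_sandwich_eq_zero_iff L F R (τ / 2)).mpr ?_⟩
    rw [mul_div_cancel₀ τ two_ne_zero]
    exact (isConjugateTime_iff_not_injective_solutionOp hu₀ hL hF hR hτ).mp h
  · rintro ⟨τ, hτ, h⟩
    refine ⟨2 * τ, by positivity, ?_⟩
    exact (isConjugateTime_iff_not_injective_solutionOp hu₀ hL hF hR (by positivity)).mpr
      ((det_endExp_sandwich_eq_zero_iff L F R τ).mp h)
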